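/- Let $G=(V,E)$ be a finite simple graph with $n$ nodes. For back-off rates $\nu=(\nu_i)_{i\in V}$ with $\nu_i>0$, let $$p_\nu(x)=\frac1Z\prod_{i\in V}\nu_i^{x_i}\prod_{(i,j)\in E}(1-x_ix_j),\qquad x\in\{0,1\}^V,$$ be the stationary distribution of the ideal CSMA model with conflict graph $G$ ($Z$ being the normalizing constant); the throughput of link $i$ is $\sum_{x:x_i=1}p_\nu(x)$. Let $\Omega=\{x\in\{0,1\}^V: x_ix_j=0 \text{ if } (i,j)\in E\}$, and let $\Gamma=\{\sum_{x\in\Omega}\xi(x)x : \sum_{x\in\Omega}\xi(x)=1,\ \xi(x)>0 \text{ for } x\in\Omega\}$ be the set of achievable throughput vectors. A region $R$ consists of a set $\mathcal V_R$ of nodes and a set $\mathcal F_R$ of factors, the factors being $f_i$ ($i\in V$) and $f_{(i,j)}$ ($(i,j)\in E$); inclusion and intersection of regions are taken componentwise. Let $R_{f_i}=(\{i\},\{f_i\})$, $R_{x_i}=(\{i\},\emptyset)$ and $R(K)=(K,\{f_{(i,j)}: i,j\in K,\ (i,j)\in E\})$ for a clique $K$. For a finite set $\mathcal R$ of regions with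 integer counting numbers $c_R$, let $\mathcal R'$ be the set of the regions in $\mathcal R$ other than the $R_{f_i}$ and $R_{x_i}$. The back-off rates given by the approximation $(\mathcal R,c)$ for the target throughputs $\phi$ are $$\nu_i=\frac{\phi_i}{(1-\phi_i)^{1+c_{R_{x_i}}}}\prod_{R\in\mathcal R':\, i\in\mathcal V_R}\Big(1-\sum_{j\in\mathcal V_R}\phi_j\Big)^{-c_R}.\qquad(1)$$ The size $n$ clique approximation has the regions $R_{f_i}$ and $R_{x_i}$ ($i\in V$) and $R(K)$ for all cliques $K$ with $|K|\ge2$. Its counting numbers are $c_{R_{f_i}}=1$, $c_{R(K)}=1-\sum_{K'\supsetneq K}c_{R(K')}$ and $c_{R_{x_i}}=-\sum_{K'\ni i,\,|K'|\ge2}c_{R(K')}$, where $K'$ ranges over cliques. The maximal-clique Kikuchi approximation has the regions $\bigcup_{k\ge0}\mathcal R_k$, where $\mathcal R_0=\{R_{f_i}: i\in V\}\cup\{R(K): K\in\mathcal K_G\}$, $\mathcal K_G$ is the set of maximal cliques of $G$, and $\mathcal R_{k+1}$ consists of the maximal elements, with respect to inclusion, among the nonempty intersections $R\cap R'$ with $R\in\mathcal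 R_k$, $R'\in\bigcup_{l\le k}\mathcal R_l$, $R\not\subseteq R'$ and $R'\not\subseteq R$. Its counting numbers are $c_R=1-\sum_{R'\supsetneq R}c_{R'}$, where $R'$ ranges over the regions of the approximation. A clique tree of $G$ is a tree $T=(\mathcal K_G,\mathcal E)$ such that, for every $v\in V$, the maximal cliques containing $v$ induce a subtree of $T$. Claim. Let $G$ be chordal (every cycle on more than three nodes has a chord) and let $\phi\in\Gamma$. Then for every clique tree $(\mathcal K_G,\mathcal E)$ of $G$ and every $i\in V$, the back-off rates (1) given by the size $n$ clique approximation and by the maximal-clique Kikuchi approximation are both equal to $$\phi_i\,\frac{\prod_{(K,K')\in\mathcal E:\, i\in K\cap K'}\big(1-\sum_{s\in K\cap K'}\phi_s\big)}{\prod_{K\in\mathcal K_G:\, i\in K}\big(1-\sum_{s\in K}\phi_s\big)}.$$ Moreover, both approximations are exact: the back-off rates that they give are positive, they achieve the throughputs $\phi$, and they are the only positive back-off rates that achieve $\phi$. -/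

import Mathlib

noncomputable section

open scoped Classical in
/-- `countingNumber S w a` is defined by downward recursion along the strict order:
`c a = w a - ∑ b ∈ S, a < b, c b`. -/
def countingNumber {α : Type*} [PartialOrder α] (S : Finset α) (w : α → ℤ) (a : α) : ℤ :=
  w a - ∑ b ∈ (S.filter (fun b => a < b)).attach, countingNumber S w b.1
termination_by (S.filter (fun b => a < b)).card
decreasing_by
  have hb := b.2
  rw [Finset.mem_filter] at hb
  apply Finset.card_lt_card
  rw [Finset.ssubset_iff_of_subset]
  · exact ⟨b.1, b.2, fun h => lt_irrefl _ (Finset.mem_filter.1 h).2⟩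
  · intro d hd
    rw [Finset.mem_filter] at hd ⊢
    exact ⟨hd.1, hb.2.trans hd.2⟩

open scoped Classical in
theorem countingNumber_eq {α : Type*} [PartialOrder α] (S : Finset α) (w : α → ℤ) (a : α) :
    countingNumber S w a
      = w a - ∑ b ∈ S.filter (fun b => a < b), countingNumber S w b := by
  rw [countingNumber,
    Finset.sum_attach (S.filter (fun b => a < b)) (fun b => countingNumber S w b)]

namespace CSMA

section Model

variable {V : Type*} [Fintype V] [DecidableEq V]

/-- The factor `1 - x_i x_j` attached to an unordered pair `{i, j}`. -/
def edgeFactor (x : V → Fin 2) : Sym2 V → ℝ :=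
  Sym2.lift ⟨fun i j => 1 - ((x i : ℕ) : ℝ) * ((x j : ℕ) : ℝ), fun i j => by ring⟩

open scoped Classical in
/-- The unnormalized weight of a state:
`(∏ i, ν_i ^ x_i) * ∏ over edges {i, j} of (1 - x_i x_j)`. -/
def weight (G : SimpleGraph V) (ν : V → ℝ) (x : V → Fin 2) : ℝ :=
  (∏ i, ν i ^ (x i : ℕ)) * ∏ e : Sym2 V with e ∈ G.edgeSet, edgeFactor x e

/-- The normalizing constant. -/
def partitionFunction (G : SimpleGraph V) (ν : V → ℝ) : ℝ :=
  ∑ x : V → Fin 2, weight G ν x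

/-- The product-form stationary distribution of the ideal CSMA model. -/
def stationary (G : SimpleGraph V) (ν : V → ℝ) (x : V → Fin 2) : ℝ :=
  weight G ν x / partitionFunction G ν

/-- The throughput of link `i`: the stationary probability that `i` is active. -/
def throughput (G : SimpleGraph V) (ν : V → ℝ) (i : V) : ℝ :=
  ∑ x : V → Fin 2 with x i = 1, stationary G ν x

open scoped Classical in
/-- The feasible states: no two neighbours are active simultaneously. -/
def feasible (G : SimpleGraph V) : Finset (V → Fin 2) :=
  Finset.univ.filter (fun x => ∀ i j, G.Adj i j → ¬ (x i = 1 ∧ x j = 1))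

/-- The set of achievable throughput vectors: the convex combinations of the feasible
states in which all weights are positive. -/
def achievable (G : SimpleGraph V) : Set (V → ℝ) :=
  {φ | ∃ ξ : (V → Fin 2) → ℝ, (∀ x ∈ feasible G, 0 < ξ x) ∧ ∑ x ∈ feasible G, ξ x = 1 ∧
    ∀ i, φ i = ∑ x ∈ feasible G, ξ x * ((x i : ℕ) : ℝ)}

/-- `ν` is the exact vector of back-off rates for the target throughputs `φ`: it is a vector of
positive rates, it achieves `φ`, and it is the only vector of positive rates that does so. -/
def IsExact (G : SimpleGraph V) (φ ν : V → ℝ) : Prop :=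
  (∀ i, 0 < ν i) ∧ (∀ i, throughput G ν i = φ i) ∧
    ∀ μ : V → ℝ, (∀ i, 0 < μ i) → (∀ i, throughput G μ i = φ i) → μ = ν

end Model

section Graphs

variable {V : Type*}

/-- A graph is chordal when every cycle on more than three nodes has a chord, that is, an edge
of the graph that joins two nonconsecutive nodes of the cycle. -/
def IsChordal (G : SimpleGraph V) : Prop :=
  ∀ (v : V) (c : G.Walk v v), c.IsCycle → 3 < c.length →
    ∃ a b : V, a ∈ c.support ∧ b ∈ c.support ∧ G.Adj a b ∧ s(a, b) ∉ c.edges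

variable [Fintype V] [DecidableEq V]

open scoped Classical in
/-- The set of maximal cliques. -/
def maxCliques (G : SimpleGraph V) : Finset (Finset V) :=
  Finset.univ.filter (Maximal (fun K : Finset V => G.IsClique (K : Set V)))

/-- A clique tree: a tree on the maximal cliques such that, for every node `v`, the maximal
cliques that contain `v` induce a subtree. -/
def IsCliqueTree (G : SimpleGraph V) (T : SimpleGraph {K : Finset V // K ∈ maxCliques G}) : Prop :=
  T.IsTree ∧ ∀ v : V, (T.induce {K | v ∈ K.1}).IsTree

/-- The set `K ∩ K'` attached to an unordered pair `{K, K'}` of maximal cliques. -/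
def separator (G : SimpleGraph V) : Sym2 {K : Finset V // K ∈ maxCliques G} → Finset V :=
  Sym2.lift ⟨fun K K' => K.1 ∩ K'.1, fun K K' => Finset.inter_comm K.1 K'.1⟩

open scoped Classical in
/-- The exact back-off rate formula of a chordal graph with clique tree `T`. -/
def chordalRate (G : SimpleGraph V) (T : SimpleGraph {K : Finset V // K ∈ maxCliques G})
    (φ : V → ℝ) (i : V) : ℝ :=
  φ i * (∏ e : Sym2 {K : Finset V // K ∈ maxCliques G} with e ∈ T.edgeSet ∧ i ∈ separator G e,
      (1 - ∑ s ∈ separator G e, φ s)) /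
    ∏ K ∈ maxCliques G with i ∈ K, (1 - ∑ s ∈ K, φ s)

end Graphs

section Regions

/-- A region is a set of variable nodes `x_i` (identified with `i : V`) together with a set of
factor nodes; the factor node `f_i` is `Sum.inl i` and `f_(i,j)` is `Sum.inr s(i, j)`.
The product order `≤` is inclusion of regions, `⊓` is the intersection and `⊥` is the empty
region. -/
abbrev Region (V : Type*) : Type _ := Finset V × Finset (V ⊕ Sym2 V)

/-- A region-based approximation: a finite set of regions, with a counting number for each. -/
structure RegionApprox (V : Type*) where
  regions : Finset (Region V)
  count : Region V → ℤ

variable {V : Type*} [Fintype V] [DecidableEq V]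

/-- The region `R_{f_i}`. -/
def fRegion (i : V) : Region V := ({i}, {Sum.inl i})

/-- The region `R_{x_i}`. -/
def xRegion (i : V) : Region V := ({i}, ∅)

open scoped Classical in
/-- The region `R(K)`: the nodes of `K`, with the factors of all edges inside `K`. -/
def cliqueRegion (G : SimpleGraph V) (K : Finset V) : Region V :=
  (K, (Finset.univ.filter (fun e : Sym2 V => e ∈ G.edgeSet ∧ ∀ v ∈ e, v ∈ K)).image Sum.inr)

/-- The regions other than the special regions `R_{f_i}` and `R_{x_i}`. -/
def RegionApprox.others (A : RegionApprox V) : Finset (Region V) :=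
  A.regions.filter (fun R => ∀ j, R ≠ fRegion j ∧ R ≠ xRegion j)

/-- The closed form for the back-off rate of node `i` at the zero gradient points of the
region-based free energy under clique belief:
`φ_i / (1 - φ_i) ^ (1 + c_{R_{x_i}}) * ∏ (1 - ∑_{j ∈ R} φ_j) ^ (- c_R)`,
the product being over the nonspecial regions `R` that contain `x_i`. -/
def RegionApprox.backoff (A : RegionApprox V) (φ : V → ℝ) (i : V) : ℝ :=
  φ i / (1 - φ i) ^ (1 + A.count (xRegion i)) *
    ∏ R ∈ A.others with i ∈ R.1, (1 - ∑ j ∈ R.1, φ j) ^ (-A.count R)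

open scoped Classical in
/-- The cliques with a size in `{2, …, k}`. -/
def cliquesUpTo (G : SimpleGraph V) (k : ℕ) : Finset (Finset V) :=
  Finset.univ.filter (fun K => G.IsClique (K : Set V) ∧ 2 ≤ K.card ∧ K.card ≤ k)

open scoped Classical in
/-- The size `k` clique approximation: the regions `R_{f_i}` (with counting number `1`), the
regions `R_{x_i}`, and the regions `R(K)` of all cliques `K` with a size in `{2, …, k}`.
The counting numbers of `R(K)`, and of `R_{x_i}` seen as the clique `{i}`, are
`c_K = 1_{|K| > 1} - ∑ c_{K'}`, the sum being over the cliques `K' ⊃ K` with a size in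
`{2, …, k}`. -/
def cliqueApprox (G : SimpleGraph V) (k : ℕ) : RegionApprox V where
  regions := Finset.univ.image fRegion ∪ Finset.univ.image xRegion ∪
    (cliquesUpTo G k).image (cliqueRegion G)
  count R := if ∃ i, R = fRegion i then 1
    else countingNumber (cliquesUpTo G k) (fun K => if 1 < K.card then 1 else 0) R.1

/-- One step of the construction of the regions of a Kikuchi approximation: `cur` is the current
level, and `all` is the union of the levels so far. The candidates for the next level are all
nonempty intersections of a region in `cur` and a region in `all` neither of which is contained
in the other. -/
def kikuchiCandidates (cur all : Finset (Region V)) : Finset (Region V) :=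
  ((cur ×ˢ all).filter
    (fun p => p.1 ⊓ p.2 ≠ ⊥ ∧ ¬ p.1 ≤ p.2 ∧ ¬ p.2 ≤ p.1)).image (fun p => p.1 ⊓ p.2)

open scoped Classical in
/-- The next level: the candidates that are not properly contained in another candidate. -/
def kikuchiNext (cur all : Finset (Region V)) : Finset (Region V) :=
  (kikuchiCandidates cur all).filter (fun R => ∀ R' ∈ kikuchiCandidates cur all, ¬ R < R')

/-- The `k`-th level of the Kikuchi construction started at `R₀`, and the union of the levels
`0, …, k`. -/
def kikuchiLevels (R₀ : Finset (Region V)) : ℕ → Finset (Region V) × Finset (Region V)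
  | 0 => (R₀, R₀)
  | k + 1 =>
    (kikuchiNext (kikuchiLevels R₀ k).1 (kikuchiLevels R₀ k).2,
      (kikuchiLevels R₀ k).2 ∪ kikuchiNext (kikuchiLevels R₀ k).1 (kikuchiLevels R₀ k).2)

open scoped Classical in
/-- The union of all levels of the Kikuchi construction. (Once a level is empty, so are all
later ones.) -/
def kikuchiRegions (R₀ : Finset (Region V)) : Finset (Region V) :=
  Finset.univ.filter (fun R => ∃ k, R ∈ (kikuchiLevels R₀ k).1)

/-- The Kikuchi approximation generated by `R₀`, with counting numbers
`c_R = 1 - ∑ c_{R'}`, the sum being over the regions `R' ⊃ R` of the approximation. -/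
def kikuchiApprox (R₀ : Finset (Region V)) : RegionApprox V where
  regions := kikuchiRegions R₀
  count := countingNumber (kikuchiRegions R₀) (fun _ => 1)

/-- The Kikuchi approximation generated by the regions `R_{f_i}` and the regions `R(K)` of the
maximal cliques `K`. -/
def maxCliqueKikuchi (G : SimpleGraph V) : RegionApprox V :=
  kikuchiApprox (Finset.univ.image fRegion ∪ (maxCliques G).image (cliqueRegion G))

end Regions

end CSMA

end

noncomputable section

namespace CSMA

/-! ### Chordal graphs: chordless paths and simplicial nodes -/

section Simplicial

variable {V : Type*}

/-! Everything rests on integer weights `d` on the nonempty cliques such that, for each nonempty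
clique `S`, the weights of the cliques containing `S` add up to 1 (`IsCliqueCounting`). Downward
induction on `S` shows that only one such `d` exists. Formula (1), for an approximation by clique
regions, is `φ i` times the product of `(1 - φ(S)) ^ (-d S)` over `S ∋ i`, where `φ(S)` is the sum
of `φ` over `S`, and `d` is the counting number with 1 added on singletons
(`IsCliqueFamily.backoff_eq`).

Three choices of `d` satisfy the condition. For the size `n` clique approximation it is the defining
recursion. For the Kikuchi approximation it follows because the regions are closed under nonempty
intersection, so each clique has a smallest region above it. For a clique tree, weight 1 on maximal
cliques and -1 for each edge separator works, because a subtree has one more node than edges. By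
uniqueness all three give the same rates.

Exactness is proved for a fourth construction of `d`. A chordal graph can be built by adding
simplicial nodes `v` with clique neighbourhood `N`; each addition puts weight 1 on `N ∪ {v}` and -1
on `N`. The resulting change of rates keeps the old throughputs and gives `v` the throughput `φ v`
(`Achieves.extend`). Uniqueness of `d` transfers this to both approximations. Rates are determined
by throughputs because a symmetrised relative entropy vanishes (`stationary_eq_of_throughput_eq`).
-/

theorem exists_chordless_path {G : SimpleGraph V} {s : Set V} {u v : V} (p : G.Walk u v)
    (hp : ∀ w ∈ p.support, w ∈ s) :
    ∃ q : G.Walk u v, q.IsPath ∧ (∀ w ∈ q.support, w ∈ s) ∧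
      ∀ a ∈ q.support, ∀ b ∈ q.support, G.Adj a b → s(a, b) ∈ q.edges := by
  classical
  have hex : ∃ n, ∃ q : G.Walk u v, (∀ w ∈ q.support, w ∈ s) ∧ q.length = n := ⟨_, p, hp, rfl⟩
  obtain ⟨q₀, hq₀, hlen⟩ := Nat.find_spec hex
  have hmin : ∀ r : G.Walk u v, (∀ w ∈ r.support, w ∈ s) → q₀.length ≤ r.length := by
    intro r hr
    rw [hlen]
    exact Nat.find_min' hex ⟨r, hr, rfl⟩
  refine ⟨q₀.bypass, q₀.bypass_isPath, fun w hw => hq₀ w (q₀.support_bypass_subset_support hw), ?_⟩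
  set q := q₀.bypass with hqdef
  have hq : ∀ w ∈ q.support, w ∈ s := fun w hw => hq₀ w (q₀.support_bypass_subset_support hw)
  have hqmin : ∀ r : G.Walk u v, (∀ w ∈ r.support, w ∈ s) → q.length ≤ r.length :=
    fun r hr => (q₀.length_bypass_le_length).trans (hmin r hr)
  -- Replacing the stretch from `i` to `j` by the edge cannot shorten a walk of minimal length, so
  -- `j = i + 1`.
  have key : ∀ i j, i < j → j ≤ q.length → G.Adj (q.getVert i) (q.getVert j) →
      s(q.getVert i, q.getVert j) ∈ q.edges := by
    intro i j hij hj hadj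
    have h := hqmin ((q.take i).append (SimpleGraph.Walk.cons hadj (q.drop j))) (by
      intro w hw
      rw [SimpleGraph.Walk.mem_support_append_iff, SimpleGraph.Walk.support_cons,
        List.mem_cons] at hw
      rcases hw with hw | rfl | hw
      · exact hq w (SimpleGraph.Walk.IsSubwalk.support_subset (q.isSubwalk_take i) hw)
      · exact hq _ (q.getVert_mem_support i)
      · exact hq w (SimpleGraph.Walk.IsSubwalk.support_subset (q.isSubwalk_drop j) hw))
    rw [SimpleGraph.Walk.length_append, SimpleGraph.Walk.length_cons,
      SimpleGraph.Walk.take_length, SimpleGraph.Walk.drop_length] at h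
    obtain rfl : j = i + 1 := by omega
    exact q.mk_mem_edges_iff_exists.2 ⟨i, by omega, rfl⟩
  intro a ha b hb hab
  obtain ⟨i, rfl, hi⟩ := SimpleGraph.Walk.mem_support_iff_exists_getVert.1 ha
  obtain ⟨j, rfl, hj⟩ := SimpleGraph.Walk.mem_support_iff_exists_getVert.1 hb
  rcases lt_trichotomy i j with h | h | h
  · exact key i j h hj hab
  · subst h
    exact (G.irrefl hab).elim
  · rw [Sym2.eq_swap]
    exact key j i h hi hab.symm

/-- In a chordal graph, two nodes with a common neighbour `y` are adjacent if they are joined by a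
walk whose inner nodes are not adjacent to `y`. -/
theorem IsChordal.adj_of_walk {G : SimpleGraph V} (hG : IsChordal G) {C : Set V} {x x' y : V}
    (hne : x ≠ x') (hyx : G.Adj y x) (hyx' : G.Adj y x') (hyC : ∀ c ∈ C, c ≠ y ∧ ¬ G.Adj y c)
    (p : G.Walk x x') (hp : ∀ w ∈ p.support, w ∈ C ∪ {x, x'}) : G.Adj x x' := by
  by_contra hnadj
  obtain ⟨q, hq, hqs, hqe⟩ := exists_chordless_path p hp
  have hyq : y ∉ q.support := by
    intro h
    rcases hqs y h with h | h | h
    · exact (hyC y h).1 rfl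
    · exact hyx.ne h
    · exact hyx'.ne h
  have hlen : 2 ≤ q.length := by
    rcases Nat.lt_or_ge q.length 2 with h | h
    · have h01 : q.length = 0 ∨ q.length = 1 := by omega
      rcases h01 with h | h
      · exact (hne (SimpleGraph.Walk.eq_of_length_eq_zero h)).elim
      · exact (hnadj (SimpleGraph.Walk.adj_of_length_eq_one h)).elim
    · exact h
  -- Closing the chordless path through `y` gives a cycle of length at least 4. It has no chord at
  -- `y` either, since the inner nodes of the path lie in `C`.
  have hcyc : (SimpleGraph.Walk.cons hyx (q.concat hyx'.symm)).IsCycle := by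
    rw [SimpleGraph.Walk.cons_isCycle_iff]
    refine ⟨(SimpleGraph.Walk.concat_isPath_iff _).2 ⟨hq, hyq⟩, ?_⟩
    rw [SimpleGraph.Walk.edges_concat, List.concat_eq_append, List.mem_append, List.mem_singleton]
    rintro (h | h)
    · exact hyq (q.fst_mem_support_of_mem_edges h)
    · rw [Sym2.eq_swap, Sym2.congr_left] at h
      exact hne h
  obtain ⟨a, b, ha, hb, hab, hnot⟩ := hG y _ hcyc (by
    rw [SimpleGraph.Walk.length_cons, SimpleGraph.Walk.length_concat]; omega)
  have hsupp : ∀ w ∈ (SimpleGraph.Walk.cons hyx (q.concat hyx'.symm)).support,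
      w = y ∨ w ∈ q.support := by
    intro w hw
    rw [SimpleGraph.Walk.support_cons, SimpleGraph.Walk.support_concat] at hw
    simp only [List.mem_cons, List.mem_append, List.not_mem_nil, or_false] at hw
    tauto
  have hy : ∀ b ∈ q.support, G.Adj y b →
      s(y, b) ∈ (SimpleGraph.Walk.cons hyx (q.concat hyx'.symm)).edges := by
    intro b hb hyb
    rw [SimpleGraph.Walk.edges_cons, SimpleGraph.Walk.edges_concat]
    rcases hqs b hb with h | h | h
    · exact ((hyC b h).2 hyb).elim
    · subst h
      simp
    · rw [Set.mem_singleton_iff] at h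
      subst h
      simp [Sym2.eq_swap]
  rcases hsupp a ha with rfl | ha' <;> rcases hsupp b hb with rfl | hb'
  · exact G.irrefl hab
  · exact hnot (hy b hb' hab)
  · rw [Sym2.eq_swap] at hnot
    exact hnot (hy a ha' hab.symm)
  · apply hnot
    rw [SimpleGraph.Walk.edges_cons, SimpleGraph.Walk.edges_concat]
    simp [hqe a ha' b hb' hab]

/-- Every nonempty set of nodes of a chordal graph contains a node whose neighbours in the set
are pairwise adjacent. -/
theorem IsChordal.exists_simplicial [DecidableEq V] {G : SimpleGraph V} (hG : IsChordal G)
    (W : Finset V) (hW : W.Nonempty) :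
    ∃ v ∈ W, ∀ a ∈ W, ∀ b ∈ W, G.Adj v a → G.Adj v b → a ≠ b → G.Adj a b := by
  classical
  induction W using Finset.strongInduction with
  | H W ih =>
  by_cases hcompl : ∀ a ∈ W, ∀ b ∈ W, a ≠ b → G.Adj a b
  · obtain ⟨v, hv⟩ := hW
    exact ⟨v, hv, fun a ha b hb _ _ hab => hcompl a ha b hb hab⟩
  push Not at hcompl
  obtain ⟨a₀, ha₀, b₀, hb₀, hab₀, hnadj₀⟩ := hcompl
  -- Take a largest connected `C ⊆ W` that leaves some node of `W` far from it. By maximality every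
  -- outside neighbour of `C` is adjacent to all far nodes (`hnear`), and chordality makes these
  -- outside neighbours a clique (`hclique`). A simplicial node of the far set is then simplicial in
  -- `W`, as its neighbours in `W` are far nodes or outside neighbours of `C`.
  let far : Finset V → V → Prop := fun C b => b ∈ W ∧ b ∉ C ∧ ∀ c ∈ C, ¬ G.Adj b c
  let good : Finset V → Prop := fun C => C ⊆ W ∧ C.Nonempty ∧ (∃ b, far C b) ∧
    ∀ a ∈ C, ∀ b ∈ C, ∃ p : G.Walk a b, ∀ w ∈ p.support, w ∈ C
  have hgood₀ : good {a₀} := by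
    refine ⟨by simpa using ha₀, by simp, ⟨b₀, hb₀, by simpa using hab₀.symm, ?_⟩, ?_⟩
    · simpa using fun h : G.Adj b₀ a₀ => hnadj₀ h.symm
    · simp only [Finset.mem_singleton]
      rintro a rfl b rfl
      exact ⟨SimpleGraph.Walk.nil, by simp⟩
  obtain ⟨C, hCmem, hCmax⟩ := (W.powerset.filter good).exists_max_image Finset.card
    ⟨{a₀}, Finset.mem_filter.2 ⟨Finset.mem_powerset.2 hgood₀.1, hgood₀⟩⟩
  obtain ⟨hCW, hCne, ⟨b, hb⟩, hCconn⟩ := (Finset.mem_filter.1 hCmem).2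
  have hnear : ∀ x ∈ W, x ∉ C → (∃ c ∈ C, G.Adj x c) → ∀ y, far C y → G.Adj y x := by
    rintro x hx hxC ⟨c, hc, hxc⟩ y hy
    by_contra hyx
    have hwx : ∀ a ∈ C, ∃ p : G.Walk x a, ∀ w ∈ p.support, w ∈ insert x C := by
      intro a ha
      obtain ⟨p, hp⟩ := hCconn c hc a ha
      refine ⟨SimpleGraph.Walk.cons hxc p, ?_⟩
      intro w hw
      rw [SimpleGraph.Walk.support_cons, List.mem_cons] at hw
      rcases hw with rfl | hw
      · exact Finset.mem_insert_self _ _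
      · exact Finset.mem_insert_of_mem (hp w hw)
    have hins : good (insert x C) := by
      refine ⟨Finset.insert_subset hx hCW, Finset.insert_nonempty _ _, ⟨y, hy.1, ?_, ?_⟩, ?_⟩
      · rw [Finset.mem_insert]
        rintro (rfl | h)
        · exact hy.2.2 c hc hxc
        · exact hy.2.1 h
      · intro d hd
        rcases Finset.mem_insert.1 hd with rfl | hd
        · exact hyx
        · exact hy.2.2 d hd
      · intro a ha d hd
        rcases Finset.mem_insert.1 ha with rfl | ha' <;>
          rcases Finset.mem_insert.1 hd with rfl | hd'
        · exact ⟨SimpleGraph.Walk.nil, by simp⟩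
        · exact hwx d hd'
        · obtain ⟨p, hp⟩ := hwx a ha'
          exact ⟨p.reverse, by simpa using hp⟩
        · obtain ⟨p, hp⟩ := hCconn a ha' d hd'
          exact ⟨p, fun w hw => Finset.mem_insert_of_mem (hp w hw)⟩
    have := hCmax _ (Finset.mem_filter.2 ⟨Finset.mem_powerset.2 hins.1, hins⟩)
    rw [Finset.card_insert_of_notMem hxC] at this
    omega
  have hclique : ∀ x ∈ W, x ∉ C → (∃ c ∈ C, G.Adj x c) → ∀ x' ∈ W, x' ∉ C →
      (∃ c ∈ C, G.Adj x' c) → x ≠ x' → G.Adj x x' := by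
    rintro x hx hxC ⟨c, hc, hxc⟩ x' hx' hxC' ⟨c', hc', hxc'⟩ hne
    obtain ⟨p, hp⟩ := hCconn c hc c' hc'
    refine hG.adj_of_walk (C := (C : Set V)) hne (hnear x hx hxC ⟨c, hc, hxc⟩ b hb)
      (hnear x' hx' hxC' ⟨c', hc', hxc'⟩ b hb) ?_
      (SimpleGraph.Walk.cons hxc (p.concat hxc'.symm)) ?_
    · rintro d hd
      exact ⟨fun h => hb.2.1 (h ▸ hd), hb.2.2 d hd⟩
    · intro w hw
      rw [SimpleGraph.Walk.support_cons, SimpleGraph.Walk.support_concat] at hw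
      simp only [List.mem_cons, List.mem_append, List.not_mem_nil,
        or_false] at hw
      rcases hw with rfl | hw | rfl
      · simp
      · exact Or.inl (hp w hw)
      · simp
  obtain ⟨v, hv, hvs⟩ := ih (W.filter (far C))
    ((Finset.filter_ssubset).2 ⟨hCne.choose, hCW hCne.choose_spec,
      fun h => h.2.1 hCne.choose_spec⟩) ⟨b, Finset.mem_filter.2 ⟨hb.1, hb⟩⟩
  have hvf := (Finset.mem_filter.1 hv).2
  have hcases : ∀ a ∈ W, G.Adj v a → far C a ∨ (a ∉ C ∧ ∃ c ∈ C, G.Adj a c) := by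
    intro a ha hva
    have haC : a ∉ C := fun h => hvf.2.2 a h hva
    by_cases h : ∃ c ∈ C, G.Adj a c
    · exact Or.inr ⟨haC, h⟩
    · push Not at h
      exact Or.inl ⟨ha, haC, h⟩
  refine ⟨v, hvf.1, fun a ha d hd hva hvd hne => ?_⟩
  rcases hcases a ha hva with h | h <;> rcases hcases d hd hvd with h' | h'
  · exact hvs a (Finset.mem_filter.2 ⟨ha, h⟩) d (Finset.mem_filter.2 ⟨hd, h'⟩) hva hvd hne
  · exact hnear d hd h'.1 h'.2 a h
  · exact (hnear a ha h.1 h.2 d h').symm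
  · exact hclique a ha h.1 h.2 d hd h'.1 h'.2 hne

end Simplicial

/-! ### Clique counting numbers and the addition of a simplicial node -/

section Counting

variable {V : Type*} [Fintype V] [DecidableEq V]

/-- Counting numbers on the nonempty cliques inside `W` such that every nonempty clique inside `W`
is counted once by the cliques that contain it. -/
structure IsCliqueCounting (G : SimpleGraph V) (W : Finset V) (d : Finset V → ℤ) : Prop where
  supp : ∀ S, d S ≠ 0 → S.Nonempty ∧ S ⊆ W ∧ G.IsClique (S : Set V)
  sum_eq : ∀ S : Finset V, S.Nonempty → S ⊆ W → G.IsClique (S : Set V) →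
    ∑ S' with S ⊆ S', d S' = 1

/-- The rates given by counting numbers on sets of nodes. -/
def cliqueRate (d : Finset V → ℤ) (φ : V → ℝ) (i : V) : ℝ :=
  φ i * ∏ S : Finset V with i ∈ S, (1 - ∑ s ∈ S, φ s) ^ (-d S)

theorem cliqueRate_pos {G : SimpleGraph V} {W : Finset V} {d : Finset V → ℤ}
    (hd : IsCliqueCounting G W d) {φ : V → ℝ} (hpos : ∀ i, 0 < φ i)
    (hlt : ∀ S : Finset V, G.IsClique (S : Set V) → ∑ s ∈ S, φ s < 1) (i : V) :
    0 < cliqueRate d φ i := by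
  refine mul_pos (hpos i) (Finset.prod_pos fun S _ => ?_)
  by_cases h : d S = 0
  · simp [h]
  · have := hlt S (hd.supp S h).2.2
    exact zpow_pos (by linarith) _

/-- Counting numbers on cliques are unique. -/
theorem IsCliqueCounting.unique {G : SimpleGraph V} {W : Finset V} {d d' : Finset V → ℤ}
    (hd : IsCliqueCounting G W d) (hd' : IsCliqueCounting G W d') : d = d' := by
  funext S
  -- Downward induction: the equation at `S` determines the value at `S` from the values on strictly
  -- larger sets.
  induction h : (Finset.univ \ S : Finset V).card using Nat.strong_induction_on generalizing S with
  | _ n ih =>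
  by_cases hS : S.Nonempty ∧ S ⊆ W ∧ G.IsClique (S : Set V)
  · have h1 := hd.sum_eq S hS.1 hS.2.1 hS.2.2
    have h2 := hd'.sum_eq S hS.1 hS.2.1 hS.2.2
    have hmem : S ∈ Finset.univ.filter (fun S' => S ⊆ S') := by simp
    rw [← Finset.add_sum_erase _ _ hmem] at h1 h2
    have : ∑ x ∈ (Finset.univ.filter (fun S' => S ⊆ S')).erase S, d x =
        ∑ x ∈ (Finset.univ.filter (fun S' => S ⊆ S')).erase S, d' x := by
      refine Finset.sum_congr rfl fun S' hS' => ?_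
      rw [Finset.mem_erase, Finset.mem_filter] at hS'
      refine ih _ ?_ S' rfl
      rw [← h]
      have hss : S ⊂ S' := lt_of_le_of_ne hS'.2.2 (Ne.symm hS'.1)
      have h3 := Finset.card_lt_card hss
      have h4 := Finset.card_le_univ S'
      rw [Finset.card_sdiff_of_subset (Finset.subset_univ _),
        Finset.card_sdiff_of_subset (Finset.subset_univ _), Finset.card_univ]
      omega
    omega
  · have h1 : d S = 0 := by
      by_contra h
      exact hS (hd.supp S h)
    have h2 : d' S = 0 := by
      by_contra h
      exact hS (hd'.supp S h)
    rw [h1, h2]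

open scoped Classical in
/-- The independent sets inside `W`. -/
def indepSets (G : SimpleGraph V) (W : Finset V) : Finset (Finset V) :=
  W.powerset.filter (fun I => ∀ a ∈ I, ∀ b ∈ I, ¬ G.Adj a b)

theorem mem_indepSets {G : SimpleGraph V} {W I : Finset V} :
    I ∈ indepSets G W ↔ I ⊆ W ∧ ∀ a ∈ I, ∀ b ∈ I, ¬ G.Adj a b := by
  simp [indepSets]

theorem sum_indepSets_insert {G : SimpleGraph V} {W N : Finset V} {v : V} (hv : v ∉ W)
    (hN : ∀ a, a ∈ N ↔ a ∈ W ∧ G.Adj v a) (h : Finset V → ℝ) :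
    ∑ I ∈ indepSets G (insert v W), h I =
      ∑ I ∈ indepSets G W, (h I + if Disjoint I N then h (insert v I) else 0) := by
  classical
  rw [indepSets, indepSets, Finset.sum_filter, Finset.sum_filter, Finset.sum_powerset_insert hv,
    ← Finset.sum_add_distrib]
  refine Finset.sum_congr rfl fun I hI => ?_
  rw [Finset.mem_powerset] at hI
  have hiff : (∀ a ∈ insert v I, ∀ b ∈ insert v I, ¬ G.Adj a b) ↔
      (∀ a ∈ I, ∀ b ∈ I, ¬ G.Adj a b) ∧ Disjoint I N := by
    rw [Finset.disjoint_left]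
    constructor
    · intro H
      refine ⟨fun a ha b hb => H a (Finset.mem_insert_of_mem ha) b (Finset.mem_insert_of_mem hb),
        fun a ha haN => ?_⟩
      exact H v (Finset.mem_insert_self _ _) a (Finset.mem_insert_of_mem ha) ((hN a).1 haN).2
    · rintro ⟨H, HN⟩ a ha b hb hab
      rcases Finset.mem_insert.1 ha with rfl | ha' <;> rcases Finset.mem_insert.1 hb with rfl | hb'
      · exact G.irrefl hab
      · exact HN hb' ((hN b).2 ⟨hI hb', hab⟩)
      · exact HN ha' ((hN a).2 ⟨hI ha', hab.symm⟩)
      · exact H a ha' b hb' hab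
  by_cases h1 : ∀ a ∈ I, ∀ b ∈ I, ¬ G.Adj a b
  · simp only [if_pos h1]
    by_cases h2 : Disjoint I N
    · rw [if_pos (hiff.2 ⟨h1, h2⟩), if_pos h2]
    · rw [if_neg (fun h => h2 (hiff.1 h).2), if_neg h2]
  · rw [if_neg h1, if_neg (fun h => h1 (hiff.1 h).1), if_neg h1, add_zero]

/-- The side condition `p` lets one lemma serve both new terms of `extendCounting`, with `True` and
with `N.Nonempty`. -/
theorem sum_ite_subset {S K : Finset V} {p : Prop} [Decidable p] :
    ∑ S' with S ⊆ S', (if S' = K ∧ p then (1 : ℤ) else 0) = if S ⊆ K ∧ p then 1 else 0 := by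
  by_cases hp : p
  · simp only [hp, and_true]
    rw [Finset.sum_ite_eq']
    simp
  · simp [hp]

/-- Adding a simplicial node `v` with neighbourhood `N` to the counting numbers. -/
def extendCounting (d : Finset V → ℤ) (v : V) (N : Finset V) (S : Finset V) : ℤ :=
  d S + (if S = insert v N ∧ True then 1 else 0) - (if S = N ∧ N.Nonempty then 1 else 0)

section Extend

variable {G : SimpleGraph V} {W N : Finset V} {v : V} {d : Finset V → ℤ}

/-- A clique through `v` lies in `insert v N` and has no old weight above it, so it sees only the
new 1. A clique avoiding `v` lies in `insert v N` exactly when it lies in `N`, so the two new terms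
cancel. -/
theorem IsCliqueCounting.extend (hv : v ∉ W) (hN : ∀ a, a ∈ N ↔ a ∈ W ∧ G.Adj v a)
    (hs : G.IsClique (N : Set V)) (hd : IsCliqueCounting G W d) :
    IsCliqueCounting G (insert v W) (extendCounting d v N) := by
  have hNW : N ⊆ W := fun a ha => ((hN a).1 ha).1
  have hvN : v ∉ N := fun h => hv (hNW h)
  constructor
  · intro S hS
    by_cases hK : S = insert v N
    · subst hK
      refine ⟨Finset.insert_nonempty _ _, Finset.insert_subset_insert _ hNW, ?_⟩
      rw [Finset.coe_insert, SimpleGraph.isClique_insert]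
      exact ⟨hs, fun b hb _ => ((hN b).1 hb).2⟩
    · by_cases hSN : S = N ∧ N.Nonempty
      · rw [hSN.1]
        exact ⟨hSN.2, hNW.trans (Finset.subset_insert _ _), hs⟩
      · have : d S ≠ 0 := by simpa [extendCounting, hK, hSN] using hS
        obtain ⟨h1, h2, h3⟩ := hd.supp S this
        exact ⟨h1, h2.trans (Finset.subset_insert _ _), h3⟩
  · intro S hne hSW hS
    simp only [extendCounting]
    rw [Finset.sum_sub_distrib, Finset.sum_add_distrib, sum_ite_subset, sum_ite_subset]
    by_cases hvS : v ∈ S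
    · have h0 : ∑ S' with S ⊆ S', d S' = 0 := by
        refine Finset.sum_eq_zero fun S' hS' => ?_
        by_contra h
        exact hv ((hd.supp S' h).2.1 ((Finset.mem_filter.1 hS').2 hvS))
      have h1 : S ⊆ insert v N := by
        intro a ha
        by_cases hav : a = v
        · simp [hav]
        · refine Finset.mem_insert_of_mem ((hN a).2 ⟨?_, hS hvS ha (Ne.symm hav)⟩)
          exact Finset.mem_of_mem_insert_of_ne (hSW ha) hav
      have h2 : ¬ (S ⊆ N) := fun h => hvN (h hvS)
      simp [h0, h1, h2]
    · have hSW' : S ⊆ W := fun a ha =>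
        Finset.mem_of_mem_insert_of_ne (hSW ha) (fun h => hvS (h ▸ ha))
      rw [hd.sum_eq S hne hSW' hS]
      have h1 : S ⊆ insert v N ↔ S ⊆ N := Finset.subset_insert_iff_of_notMem hvS
      by_cases h2 : S ⊆ N
      · simp [h1, h2, hne.mono h2]
      · simp [h1, h2]

variable {φ : V → ℝ}

theorem cliqueRate_extend (hvN : v ∉ N)
    (hK : 1 - ∑ s ∈ insert v N, φ s ≠ 0) (hN0 : 1 - ∑ s ∈ N, φ s ≠ 0) (i : V) :
    cliqueRate (extendCounting d v N) φ i = cliqueRate d φ i *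
      (if i ∈ insert v N then (1 - ∑ s ∈ insert v N, φ s)⁻¹ else 1) *
      (if i ∈ N then 1 - ∑ s ∈ N, φ s else 1) := by
  have hne : insert v N ≠ N := fun h => hvN (h ▸ Finset.mem_insert_self v N)
  have hpt : ∀ S : Finset V, i ∈ S → (1 - ∑ s ∈ S, φ s) ^ (-extendCounting d v N S) =
      (1 - ∑ s ∈ S, φ s) ^ (-d S) * (if S = insert v N then (1 - ∑ s ∈ S, φ s)⁻¹ else 1) *
        (if S = N then (1 - ∑ s ∈ S, φ s) else 1) := by
    intro S hiS
    by_cases h1 : S = insert v N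
    · subst h1
      simp only [extendCounting, hne, and_true, if_true, false_and, if_false, sub_zero, mul_one]
      rw [neg_add, zpow_add₀ hK, zpow_neg_one]
    · by_cases h2 : S = N
      · have h3 : N.Nonempty := ⟨i, h2 ▸ hiS⟩
        subst h2
        simp only [extendCounting, h1, and_true, if_true, if_false, h3, add_zero, mul_one]
        rw [show -(d S - 1) = -d S + 1 by ring, zpow_add₀ hN0, zpow_one]
      · simp [extendCounting, h1, h2]
  unfold cliqueRate
  rw [Finset.prod_congr rfl (fun S hS => hpt S (Finset.mem_filter.1 hS).2),
    Finset.prod_mul_distrib, Finset.prod_mul_distrib, Finset.prod_ite_eq', Finset.prod_ite_eq']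
  simp only [Finset.mem_filter, Finset.mem_univ, true_and]
  ring

/-- The sums over independent sets for rates that achieve `φ` on `W`. -/
def Achieves (G : SimpleGraph V) (W : Finset V) (φ ν : V → ℝ) : Prop :=
  ∀ i ∈ W, ∑ I ∈ indepSets G W, (if i ∈ I then ∏ j ∈ I, ν j else 0) =
    φ i * ∑ I ∈ indepSets G W, ∏ j ∈ I, ν j

/-- An independent set meets a clique in at most one node. Hence the weight of the event that `N` is
hit is the sum of the weights of its nodes being active. -/
theorem sum_mem_eq {I : Finset V} (hs : G.IsClique (N : Set V))
    (hI : ∀ a ∈ I, ∀ b ∈ I, ¬ G.Adj a b) (x : ℝ) :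
    ∑ n ∈ N, (if n ∈ I then x else 0) = if Disjoint I N then 0 else x := by
  by_cases h : Disjoint I N
  · rw [if_pos h]
    refine Finset.sum_eq_zero fun n hn => ?_
    rw [if_neg (fun h' => Finset.disjoint_left.1 h h' hn)]
  · rw [if_neg h]
    obtain ⟨n, hnI, hnN⟩ := Finset.not_disjoint_iff.1 h
    rw [Finset.sum_eq_single_of_mem n hnN, if_pos hnI]
    intro m hm hmn
    rw [if_neg (fun h' => hI m h' n hnI (hs hm hnN hmn))]

theorem prod_ite_mem_eq {I : Finset V} (hs : G.IsClique (N : Set V))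
    (hI : ∀ a ∈ I, ∀ b ∈ I, ¬ G.Adj a b) (x : ℝ) :
    ∏ n ∈ I, (if n ∈ N then x else 1) = if Disjoint I N then 1 else x := by
  by_cases h : Disjoint I N
  · rw [if_pos h]
    refine Finset.prod_eq_one fun n hn => ?_
    rw [if_neg (fun h' => Finset.disjoint_left.1 h hn h')]
  · rw [if_neg h]
    obtain ⟨n, hnI, hnN⟩ := Finset.not_disjoint_iff.1 h
    rw [Finset.prod_eq_single_of_mem n hnI, if_pos hnN]
    intro m hm hmn
    exact if_neg (fun h' => hI m hm n hnI (hs h' hnN hmn))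

/-- Put `a = 1 + ν v`. An independent set of `W` disjoint from `N` gains the factor `a` from the
choice of adding `v` or not; one that meets `N` gains it from the changed rate of its unique node in
`N`. So the partition function is multiplied by `a` and the marginal law on `W` is unchanged. The
throughput of `v` is `ν v / a` times the probability `1 - φ(N)` that `N` is idle, which is `φ v`. -/
theorem Achieves.extend {ν ν' : V → ℝ} (hv : v ∉ W)
    (hN : ∀ a, a ∈ N ↔ a ∈ W ∧ G.Adj v a) (hs : G.IsClique (N : Set V))
    (hK : 1 - ∑ s ∈ insert v N, φ s ≠ 0)
    (hνv : ν v = φ v / (1 - ∑ s ∈ insert v N, φ s))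
    (hν : ∀ i ∈ W, ν i = ν' i *
      if i ∈ N then (1 - ∑ s ∈ N, φ s) / (1 - ∑ s ∈ insert v N, φ s) else 1)
    (h : Achieves G W φ ν') : Achieves G (insert v W) φ ν := by
  have hNW : N ⊆ W := fun a ha => ((hN a).1 ha).1
  have hvN : v ∉ N := fun h => hv (hNW h)
  set a := (1 - ∑ s ∈ N, φ s) / (1 - ∑ s ∈ insert v N, φ s) with ha
  have hνa : 1 + ν v = a := by
    rw [hνv, ha, eq_div_iff hK, add_mul, div_mul_cancel₀ _ hK, Finset.sum_insert hvN]
    ring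
  have hf : ∀ I ∈ indepSets G W,
      ∏ j ∈ I, ν j = (∏ j ∈ I, ν' j) * if Disjoint I N then 1 else a := by
    intro I hI
    rw [mem_indepSets] at hI
    rw [Finset.prod_congr rfl (fun j hj => hν j (hI.1 hj)), Finset.prod_mul_distrib,
      prod_ite_mem_eq hs hI.2]
  have hins : ∀ I ∈ indepSets G W, ∏ j ∈ insert v I, ν j = ν v * ∏ j ∈ I, ν j := by
    intro I hI
    exact Finset.prod_insert (fun h => hv ((mem_indepSets.1 hI).1 h))
  have hpt : ∀ I ∈ indepSets G W, (∏ j ∈ I, ν j) +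
      (if Disjoint I N then ∏ j ∈ insert v I, ν j else 0) = a * ∏ j ∈ I, ν' j := by
    intro I hI
    rw [hins I hI, hf I hI, ← hνa]
    split_ifs <;> ring
  have hZ : ∑ I ∈ indepSets G (insert v W), ∏ j ∈ I, ν j =
      a * ∑ I ∈ indepSets G W, ∏ j ∈ I, ν' j := by
    rw [sum_indepSets_insert hv hN, Finset.mul_sum]
    exact Finset.sum_congr rfl hpt
  intro i hi
  rw [hZ, sum_indepSets_insert hv hN]
  rcases Finset.mem_insert.1 hi with rfl | hiW
  -- The indicator that `I` misses `N` is written as 1 minus the sum of the indicators of `n ∈ I`,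
  -- to which the hypothesis on `ν'` applies.
  · have h1 : ∀ I ∈ indepSets G W, ((if i ∈ I then ∏ j ∈ I, ν j else 0) +
        if Disjoint I N then (if i ∈ insert i I then ∏ j ∈ insert i I, ν j else 0) else 0) =
        ν i * (∏ j ∈ I, ν' j - ∑ n ∈ N, if n ∈ I then ∏ j ∈ I, ν' j else 0) := by
      intro I hI
      rw [if_neg (fun h => hv ((mem_indepSets.1 hI).1 h)), if_pos (Finset.mem_insert_self _ _),
        hins I hI, hf I hI, sum_mem_eq hs (mem_indepSets.1 hI).2]
      split_ifs <;> ring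
    rw [Finset.sum_congr rfl h1, ← Finset.mul_sum, Finset.sum_sub_distrib, Finset.sum_comm,
      Finset.sum_congr rfl (fun n hn => h n (hNW hn)), ← Finset.sum_mul, hνv, ha]
    ring
  · have h1 : ∀ I ∈ indepSets G W, ((if i ∈ I then ∏ j ∈ I, ν j else 0) +
        if Disjoint I N then (if i ∈ insert v I then ∏ j ∈ insert v I, ν j else 0) else 0) =
        a * if i ∈ I then ∏ j ∈ I, ν' j else 0 := by
      intro I hI
      have hiv : i ≠ v := fun h => hv (h ▸ hiW)
      by_cases hiI : i ∈ I
      · simp only [hiI, if_true, Finset.mem_insert_of_mem hiI, hpt I hI]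
      · simp [hiI, hiv]
    rw [Finset.sum_congr rfl h1, ← Finset.mul_sum, h i hiW]
    ring

end Extend

theorem IsChordal.exists_counting {G : SimpleGraph V} (hG : IsChordal G) {φ : V → ℝ}
    (hlt : ∀ S : Finset V, G.IsClique (S : Set V) → ∑ s ∈ S, φ s < 1) (W : Finset V) :
    ∃ d, IsCliqueCounting G W d ∧ Achieves G W φ (cliqueRate d φ) := by
  classical
  induction h : W.card generalizing W with
  | zero =>
    rw [Finset.card_eq_zero] at h
    subst h
    refine ⟨fun _ => 0, ⟨fun S hS => (hS rfl).elim, fun S hne hS => ?_⟩, fun i hi => ?_⟩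
    · rw [Finset.subset_empty] at hS
      simp [hS] at hne
    · simp at hi
  | succ n ih =>
    obtain ⟨v, hvW, hsimp⟩ := hG.exists_simplicial W (Finset.card_pos.1 (by omega))
    obtain ⟨W, hv, rfl⟩ : ∃ W', v ∉ W' ∧ insert v W' = W :=
      ⟨W.erase v, Finset.notMem_erase _ _, Finset.insert_erase hvW⟩
    obtain ⟨d, hd, hA⟩ := ih W (by rw [Finset.card_insert_of_notMem hv] at h; omega)
    let N := W.filter (fun a => G.Adj v a)
    have hN : ∀ a, a ∈ N ↔ a ∈ W ∧ G.Adj v a := fun a => Finset.mem_filter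
    have hNW : N ⊆ W := Finset.filter_subset _ _
    have hvN : v ∉ N := fun h => hv (hNW h)
    have hs : G.IsClique (N : Set V) := fun a ha b hb hab =>
      hsimp a (Finset.mem_insert_of_mem (hNW ha)) b (Finset.mem_insert_of_mem (hNW hb))
        ((hN a).1 ha).2 ((hN b).1 hb).2 hab
    have hKc : G.IsClique ((insert v N : Finset V) : Set V) := by
      rw [Finset.coe_insert, SimpleGraph.isClique_insert]
      exact ⟨hs, fun b hb _ => ((hN b).1 hb).2⟩
    have hK : 1 - ∑ s ∈ insert v N, φ s ≠ 0 := by linarith [hlt _ hKc]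
    have hN0 : 1 - ∑ s ∈ N, φ s ≠ 0 := by linarith [hlt _ hs]
    refine ⟨extendCounting d v N, hd.extend hv hN hs, hA.extend hv hN hs hK ?_ ?_⟩
    · rw [cliqueRate_extend hvN hK hN0, if_pos (Finset.mem_insert_self _ _), if_neg hvN, mul_one,
        div_eq_mul_inv]
      congr 1
      -- The old numbers vanish on every set containing `v`, so the old rate at `v` is just `φ v`.
      rw [cliqueRate, Finset.prod_eq_one, mul_one]
      intro S hS
      have : d S = 0 := by
        by_contra h
        exact hv ((hd.supp S h).2.1 (Finset.mem_filter.1 hS).2)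
      simp [this]
    · intro i hi
      have hiv : i ≠ v := fun h => hv (h ▸ hi)
      rw [cliqueRate_extend hvN hK hN0]
      simp only [Finset.mem_insert, hiv, false_or]
      split_ifs
      · rw [div_eq_mul_inv]
        ring
      · ring

end Counting

/-! ### The stationary distribution: throughputs, uniqueness of the rates, exactness -/

section Exactness

variable {V : Type*} [Fintype V] [DecidableEq V]

theorem mem_feasible {G : SimpleGraph V} {x : V → Fin 2} :
    x ∈ feasible G ↔ ∀ i j, G.Adj i j → ¬ (x i = 1 ∧ x j = 1) := by
  simp [feasible]

theorem fin_two_val_cast (a : Fin 2) : ((a : ℕ) : ℝ) = if a = 1 then 1 else 0 := by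
  fin_cases a <;> simp

theorem weight_eq (G : SimpleGraph V) (ν : V → ℝ) (x : V → Fin 2) :
    weight G ν x = if x ∈ feasible G then ∏ i with x i = 1, ν i else 0 := by
  classical
  have h1 : ∏ i, ν i ^ (x i : ℕ) = ∏ i with x i = 1, ν i := by
    rw [Finset.prod_filter]
    refine Finset.prod_congr rfl fun i _ => ?_
    generalize x i = a
    fin_cases a <;> simp
  rw [weight, h1]
  split_ifs with hx
  · refine (congrArg _ (Finset.prod_eq_one fun e he => ?_)).trans (mul_one _)
    induction e with
    | _ i j =>
    have h2 := mem_feasible.1 hx i j (by simpa using he)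
    simp only [edgeFactor, Sym2.lift_mk, fin_two_val_cast]
    by_cases h3 : x i = 1 <;> by_cases h4 : x j = 1 <;> simp_all
  · rw [mem_feasible] at hx
    push Not at hx
    obtain ⟨i, j, hij, hi, hj⟩ := hx
    rw [Finset.prod_eq_zero (i := s(i, j)) (by simpa using hij), mul_zero]
    simp [edgeFactor, hi, hj]

theorem sum_feasible_eq_sum_indepSets (G : SimpleGraph V) (F : Finset V → ℝ) :
    ∑ x ∈ feasible G, F (Finset.univ.filter (fun i => x i = 1)) =
      ∑ I ∈ indepSets G Finset.univ, F I := by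
  refine Finset.sum_bij' (fun x _ => Finset.univ.filter (fun i => x i = 1))
    (fun I _ i => if i ∈ I then 1 else 0) ?_ ?_ ?_ ?_ ?_
  · intro x hx
    rw [mem_indepSets]
    refine ⟨Finset.subset_univ _, fun a ha b hb hab => ?_⟩
    exact mem_feasible.1 hx a b hab ⟨by simpa using ha, by simpa using hb⟩
  · intro I hI
    rw [mem_feasible]
    rintro i j hij ⟨hi, hj⟩
    exact (mem_indepSets.1 hI).2 i (by by_contra h; simp [h] at hi) j
      (by by_contra h; simp [h] at hj) hij
  · intro x _
    funext i
    simp only [Finset.mem_filter, Finset.mem_univ, true_and]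
    generalize x i = a
    fin_cases a <;> simp
  · intro I _
    ext i
    simp
  · intro x _
    rfl

theorem partitionFunction_eq (G : SimpleGraph V) (ν : V → ℝ) :
    partitionFunction G ν = ∑ I ∈ indepSets G Finset.univ, ∏ j ∈ I, ν j := by
  rw [← sum_feasible_eq_sum_indepSets G (fun I => ∏ j ∈ I, ν j), partitionFunction]
  simp only [weight_eq]
  rw [Finset.sum_ite_mem, Finset.univ_inter]

theorem throughput_eq_sum_feasible (G : SimpleGraph V) (ν : V → ℝ) (i : V) :
    throughput G ν i = ∑ x ∈ feasible G, stationary G ν x * if x i = 1 then 1 else 0 := by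
  rw [throughput, Finset.sum_filter, ← Finset.sum_subset (Finset.subset_univ (feasible G))]
  · exact Finset.sum_congr rfl fun x _ => by split_ifs <;> simp
  · intro x _ hx
    simp [stationary, weight_eq, hx]

theorem throughput_eq (G : SimpleGraph V) (ν : V → ℝ) (i : V) :
    throughput G ν i = (∑ I ∈ indepSets G Finset.univ, if i ∈ I then ∏ j ∈ I, ν j else 0) /
      partitionFunction G ν := by
  rw [throughput_eq_sum_feasible,
    ← sum_feasible_eq_sum_indepSets G (fun I => if i ∈ I then ∏ j ∈ I, ν j else 0),
    Finset.sum_div]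
  refine Finset.sum_congr rfl fun x hx => ?_
  rw [stationary, weight_eq, if_pos hx]
  by_cases h : x i = 1 <;> simp [h]

theorem partitionFunction_pos (G : SimpleGraph V) {ν : V → ℝ} (hν : ∀ i, 0 < ν i) :
    0 < partitionFunction G ν := by
  rw [partitionFunction_eq]
  refine Finset.sum_pos (fun I _ => Finset.prod_pos fun i _ => hν i) ⟨∅, ?_⟩
  simp [mem_indepSets]

theorem stationary_pos {G : SimpleGraph V} {ν : V → ℝ} (hν : ∀ i, 0 < ν i) {x : V → Fin 2}
    (hx : x ∈ feasible G) : 0 < stationary G ν x := by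
  rw [stationary, weight_eq, if_pos hx]
  exact div_pos (Finset.prod_pos fun i _ => hν i) (partitionFunction_pos G hν)

theorem sum_stationary {G : SimpleGraph V} {ν : V → ℝ} (hν : ∀ i, 0 < ν i) :
    ∑ x ∈ feasible G, stationary G ν x = 1 := by
  simp only [stationary]
  rw [← Finset.sum_div, div_eq_one_iff_eq (partitionFunction_pos G hν).ne', partitionFunction]
  refine Finset.sum_subset (Finset.subset_univ _) fun x _ hx => ?_
  rw [weight_eq, if_neg hx]

theorem log_stationary {G : SimpleGraph V} {ν : V → ℝ} (hν : ∀ i, 0 < ν i) {x : V → Fin 2}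
    (hx : x ∈ feasible G) : Real.log (stationary G ν x) =
      (∑ i, Real.log (ν i) * if x i = 1 then 1 else 0) - Real.log (partitionFunction G ν) := by
  rw [stationary, weight_eq, if_pos hx, Real.log_div (Finset.prod_pos fun i _ => hν i).ne'
    (partitionFunction_pos G hν).ne', Real.log_prod (fun i _ => (hν i).ne'), Finset.sum_filter]
  simp

theorem zero_mem_feasible (G : SimpleGraph V) : (fun _ => 0) ∈ feasible G := by
  simp [mem_feasible]

theorem single_mem_feasible (G : SimpleGraph V) (i : V) :
    (fun j => if j = i then 1 else 0) ∈ feasible G := by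
  rw [mem_feasible]
  rintro a b hab ⟨ha, hb⟩
  have ha' : a = i := by by_contra h; simp [h] at ha
  have hb' : b = i := by by_contra h; simp [h] at hb
  exact hab.ne (ha'.trans hb'.symm)

theorem sub_mul_log_sub_log_nonneg {a b : ℝ} (ha : 0 < a) (hb : 0 < b) :
    0 ≤ (a - b) * (Real.log a - Real.log b) := by
  rcases le_total a b with h | h
  · exact mul_nonneg_of_nonpos_of_nonpos (by linarith) (by linarith [Real.log_le_log ha h])
  · exact mul_nonneg (by linarith) (by linarith [Real.log_le_log hb h])

/-- On feasible states the log-probability is affine in the state. The sum of `(p - q) * (log p -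
log q)` is therefore a linear combination of throughput differences and of the difference of total
masses, hence zero. Its terms are nonnegative, so each vanishes. -/
theorem stationary_eq_of_throughput_eq {G : SimpleGraph V} {μ ν : V → ℝ} (hμ : ∀ i, 0 < μ i)
    (hν : ∀ i, 0 < ν i) (h : ∀ i, throughput G μ i = throughput G ν i) {x : V → Fin 2}
    (hx : x ∈ feasible G) : stationary G μ x = stationary G ν x := by
  have hsum : ∑ x ∈ feasible G, (stationary G μ x - stationary G ν x) *
      (Real.log (stationary G μ x) - Real.log (stationary G ν x)) = 0 := by
    have h1 : ∀ x ∈ feasible G, (stationary G μ x - stationary G ν x) *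
        (Real.log (stationary G μ x) - Real.log (stationary G ν x)) =
        (∑ i, (Real.log (μ i) - Real.log (ν i)) *
          (stationary G μ x * (if x i = 1 then 1 else 0) -
            stationary G ν x * if x i = 1 then 1 else 0)) +
        (Real.log (partitionFunction G ν) - Real.log (partitionFunction G μ)) *
          (stationary G μ x - stationary G ν x) := by
      intro x hx
      have h2 : ∑ i, (Real.log (μ i) - Real.log (ν i)) *
          (stationary G μ x * (if x i = 1 then 1 else 0) -
            stationary G ν x * if x i = 1 then 1 else 0) =
          (stationary G μ x - stationary G ν x) *
            ((∑ i, Real.log (μ i) * if x i = 1 then 1 else 0) -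
              ∑ i, Real.log (ν i) * if x i = 1 then 1 else 0) := by
        rw [← Finset.sum_sub_distrib, Finset.mul_sum]
        exact Finset.sum_congr rfl fun i _ => by ring
      rw [log_stationary hμ hx, log_stationary hν hx, h2]
      ring
    rw [Finset.sum_congr rfl h1, Finset.sum_add_distrib, Finset.sum_comm, ← Finset.mul_sum,
      Finset.sum_sub_distrib, sum_stationary hμ, sum_stationary hν, sub_self, mul_zero, add_zero]
    refine Finset.sum_eq_zero fun i _ => ?_
    rw [← Finset.mul_sum, Finset.sum_sub_distrib, ← throughput_eq_sum_feasible,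
      ← throughput_eq_sum_feasible, h i, sub_self, mul_zero]
  have h0 := (Finset.sum_eq_zero_iff_of_nonneg (fun y hy =>
    sub_mul_log_sub_log_nonneg (stationary_pos hμ hy) (stationary_pos hν hy))).1 hsum x hx
  rcases mul_eq_zero.1 h0 with h0 | h0
  · exact sub_eq_zero.1 h0
  · exact Real.log_injOn_pos (stationary_pos hμ hx) (stationary_pos hν hx) (sub_eq_zero.1 h0)

/-- The throughputs determine the positive back-off rates. -/
theorem eq_of_throughput_eq {G : SimpleGraph V} {μ ν : V → ℝ} (hμ : ∀ i, 0 < μ i)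
    (hν : ∀ i, 0 < ν i) (h : ∀ i, throughput G μ i = throughput G ν i) : μ = ν := by
  -- The idle state has weight 1 and yields the normalizing constant; the states with one active
  -- node then yield the rates.
  have h0 := stationary_eq_of_throughput_eq hμ hν h (zero_mem_feasible G)
  have hZ : partitionFunction G μ = partitionFunction G ν := by
    simpa [stationary, weight_eq, zero_mem_feasible] using h0
  funext i
  have h1 := stationary_eq_of_throughput_eq hμ hν h (single_mem_feasible G i)
  rw [stationary, stationary, hZ, div_left_inj' (partitionFunction_pos G hν).ne', weight_eq,
    weight_eq, if_pos (single_mem_feasible G i), if_pos (single_mem_feasible G i)] at h1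
  simpa [Finset.filter_eq'] using h1

theorem achievable_pos {G : SimpleGraph V} {φ : V → ℝ} (hφ : φ ∈ achievable G) (i : V) :
    0 < φ i := by
  obtain ⟨ξ, hξ, -, h⟩ := hφ
  rw [h i]
  refine Finset.sum_pos' (fun x hx => mul_nonneg (hξ x hx).le (Nat.cast_nonneg _))
    ⟨_, single_mem_feasible G i, ?_⟩
  simpa using hξ _ (single_mem_feasible G i)

/-- A feasible state has at most one active node in a clique; the inequality is strict because the
idle state has positive weight and contributes nothing. -/
theorem sum_clique_lt_one {G : SimpleGraph V} {φ : V → ℝ} (hφ : φ ∈ achievable G)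
    (S : Finset V) (hS : G.IsClique (S : Set V)) : ∑ s ∈ S, φ s < 1 := by
  obtain ⟨ξ, hξ, hsum, h⟩ := hφ
  simp only [h]
  rw [Finset.sum_comm, ← hsum]
  have hle : ∀ x ∈ feasible G, ∑ s ∈ S, ((x s : ℕ) : ℝ) ≤ 1 := by
    intro x hx
    simp only [fin_two_val_cast]
    by_cases hex : ∃ s ∈ S, x s = 1
    · obtain ⟨s, hs, hxs⟩ := hex
      rw [Finset.sum_eq_single_of_mem s hs, if_pos hxs]
      intro t ht hts
      exact if_neg fun hxt => mem_feasible.1 hx t s (hS ht hs hts) ⟨hxt, hxs⟩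
    · push Not at hex
      rw [Finset.sum_eq_zero fun s hs => if_neg (hex s hs)]
      exact zero_le_one
  refine Finset.sum_lt_sum (fun x hx => ?_) ⟨_, zero_mem_feasible G, ?_⟩
  · rw [← Finset.mul_sum]
    exact mul_le_of_le_one_right (hξ x hx).le (hle x hx)
  · simpa using hξ _ (zero_mem_feasible G)

/-- In a chordal graph the rates given by any counting numbers on cliques are exact. -/
theorem IsChordal.isExact_cliqueRate {G : SimpleGraph V} (hG : IsChordal G) {φ : V → ℝ}
    (hφ : φ ∈ achievable G) {d : Finset V → ℤ} (hd : IsCliqueCounting G Finset.univ d) :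
    IsExact G φ (cliqueRate d φ) := by
  obtain ⟨d', hd', hA⟩ := hG.exists_counting (sum_clique_lt_one hφ) Finset.univ
  -- Uniqueness replaces the counting numbers built by elimination with the given ones.
  obtain rfl := hd.unique hd'
  have hpos := cliqueRate_pos hd (achievable_pos hφ) (sum_clique_lt_one hφ)
  have hthr : ∀ i, throughput G (cliqueRate d φ) i = φ i := by
    intro i
    rw [throughput_eq, hA i (Finset.mem_univ i), ← partitionFunction_eq,
      mul_div_cancel_right₀ _ (partitionFunction_pos G hpos).ne']
  exact ⟨hpos, hthr, fun μ hμ h => eq_of_throughput_eq hμ hpos fun i => (h i).trans (hthr i).symm⟩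

end Exactness

/-! ### Formula (1) as a product over cliques -/

section Families

variable {V : Type*} [Fintype V] [DecidableEq V]

/-- `A` is an approximation whose regions other than `R_{f_i}` are the regions `R(S)`, `S ∈ 𝒯`,
for a family `𝒯` of nonempty cliques that contains all singletons. -/
structure IsCliqueFamily (G : SimpleGraph V) (A : RegionApprox V) (𝒯 : Finset (Finset V)) :
    Prop where
  regions_eq : A.regions = Finset.univ.image fRegion ∪ 𝒯.image (cliqueRegion G)
  clique : ∀ S ∈ 𝒯, S.Nonempty ∧ G.IsClique (S : Set V)
  singleton : ∀ i, {i} ∈ 𝒯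

/-- The counting numbers on sets of nodes given by an approximation by clique regions. -/
def familyCounting (G : SimpleGraph V) (A : RegionApprox V) (𝒯 : Finset (Finset V))
    (S : Finset V) : ℤ :=
  (if S.card = 1 then 1 else 0) + if S ∈ 𝒯 then A.count (cliqueRegion G S) else 0

theorem cliqueRegion_singleton (G : SimpleGraph V) (i : V) :
    cliqueRegion G {i} = xRegion i := by
  classical
  refine Prod.ext rfl ?_
  simp only [cliqueRegion, xRegion, Finset.image_eq_empty]
  rw [Finset.filter_eq_empty_iff]
  rintro e - ⟨he, h⟩
  induction e with
  | _ a b =>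
  have ha : a = i := by simpa using h a (by simp)
  have hb : b = i := by simpa using h b (by simp)
  exact (G.ne_of_adj he) (ha.trans hb.symm)

theorem cliqueRegion_injective (G : SimpleGraph V) : Function.Injective (cliqueRegion G) :=
  fun _ _ h => congrArg Prod.fst h

theorem cliqueRegion_le_iff {G : SimpleGraph V} {S S' : Finset V} :
    cliqueRegion G S ≤ cliqueRegion G S' ↔ S ⊆ S' := by
  classical
  refine ⟨fun h => h.1, fun h => ⟨h, ?_⟩⟩
  refine Finset.image_subset_image fun e he => ?_
  rw [Finset.mem_filter] at he ⊢
  exact ⟨he.1, he.2.1, fun v hv => h (he.2.2 v hv)⟩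

theorem cliqueRegion_inf (G : SimpleGraph V) (S S' : Finset V) :
    cliqueRegion G S ⊓ cliqueRegion G S' = cliqueRegion G (S ∩ S') := by
  refine Prod.ext rfl ?_
  change (cliqueRegion G S).2 ∩ (cliqueRegion G S').2 = _
  ext f
  simp only [cliqueRegion, Finset.mem_inter, Finset.mem_image, Finset.mem_filter, Finset.mem_univ,
    true_and]
  constructor
  · rintro ⟨⟨e, he, rfl⟩, ⟨e', he', h⟩⟩
    obtain rfl := Sum.inr_injective h
    exact ⟨_, ⟨he.1, fun v hv => ⟨he.2 v hv, he'.2 v hv⟩⟩, rfl⟩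
  · rintro ⟨e, he, rfl⟩
    exact ⟨⟨e, ⟨he.1, fun v hv => (he.2 v hv).1⟩, rfl⟩, ⟨e, ⟨he.1, fun v hv => (he.2 v hv).2⟩, rfl⟩⟩

theorem inl_notMem_cliqueRegion (G : SimpleGraph V) (S : Finset V) (i : V) :
    Sum.inl i ∉ (cliqueRegion G S).2 := by
  simp [cliqueRegion]

theorem not_fRegion_le_cliqueRegion (G : SimpleGraph V) (S : Finset V) (i : V) :
    ¬ fRegion i ≤ cliqueRegion G S :=
  fun h => inl_notMem_cliqueRegion G S i (h.2 (by simp [fRegion]))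

theorem fRegion_ne_cliqueRegion (G : SimpleGraph V) (S : Finset V) (i : V) :
    fRegion i ≠ cliqueRegion G S :=
  fun h => not_fRegion_le_cliqueRegion G S i h.le

theorem fRegion_injective : Function.Injective (fRegion : V → Region V) := by
  intro i j h
  simpa [fRegion] using congrArg Prod.fst h

variable {G : SimpleGraph V} {A : RegionApprox V} {𝒯 : Finset (Finset V)}

theorem IsCliqueFamily.others_eq (h : IsCliqueFamily G A 𝒯) :
    A.others = (𝒯.filter (fun S => S.card ≠ 1)).image (cliqueRegion G) := by
  ext R
  rw [RegionApprox.others, h.regions_eq]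
  simp only [Finset.mem_filter, Finset.mem_union, Finset.mem_image, Finset.mem_univ, true_and]
  constructor
  · rintro ⟨⟨j, rfl⟩ | ⟨S, hS, rfl⟩, h2⟩
    · exact ((h2 j).1 rfl).elim
    · refine ⟨S, ⟨hS, fun hc => ?_⟩, rfl⟩
      obtain ⟨i, rfl⟩ := Finset.card_eq_one.1 hc
      exact (h2 i).2 (cliqueRegion_singleton G i)
  · rintro ⟨S, ⟨hS, hc⟩, rfl⟩
    refine ⟨Or.inr ⟨S, hS, rfl⟩, fun j => ⟨(fRegion_ne_cliqueRegion G S j).symm, fun hx => ?_⟩⟩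
    rw [← cliqueRegion_singleton G] at hx
    exact hc (by rw [cliqueRegion_injective G hx, Finset.card_singleton])

/-- The power of `1 - φ i` in (1) is the term of the singleton `{i}`: the extra 1 in its exponent is
the singleton term of `familyCounting`. The remaining factors match the nonspecial regions. -/
theorem IsCliqueFamily.backoff_eq (h : IsCliqueFamily G A 𝒯) (φ : V → ℝ) :
    A.backoff φ = cliqueRate (familyCounting G A 𝒯) φ := by
  funext i
  have hmem : ({i} : Finset V) ∈ Finset.univ.filter (fun S : Finset V => i ∈ S) := by simp
  have h1 : familyCounting G A 𝒯 {i} = 1 + A.count (xRegion i) := by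
    simp [familyCounting, h.singleton, cliqueRegion_singleton]
  rw [RegionApprox.backoff, cliqueRate, ← Finset.mul_prod_erase _ _ hmem, h1,
    Finset.sum_singleton, zpow_neg, div_eq_mul_inv, mul_assoc]
  congr 2
  rw [h.others_eq, Finset.filter_image, Finset.prod_image (cliqueRegion_injective G).injOn]
  change ∏ S ∈ (𝒯.filter (fun S => S.card ≠ 1)).filter (fun S => i ∈ S),
    (1 - ∑ j ∈ S, φ j) ^ (-A.count (cliqueRegion G S)) = _
  refine Finset.prod_subset_one_on_sdiff ?_ ?_ ?_
  · intro S hS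
    rw [Finset.mem_filter, Finset.mem_filter] at hS
    simp only [Finset.mem_erase, Finset.mem_filter, Finset.mem_univ, true_and]
    refine ⟨?_, hS.2⟩
    rintro rfl
    simp at hS
  · intro S hS
    simp only [Finset.mem_sdiff, Finset.mem_erase, Finset.mem_filter, Finset.mem_univ,
      true_and] at hS
    have hc : S.card ≠ 1 := by
      intro hc
      obtain ⟨j, rfl⟩ := Finset.card_eq_one.1 hc
      have : i = j := by simpa using hS.1.2
      exact hS.1.1 (by rw [this])
    have hT : S ∉ 𝒯 := fun hT => hS.2 ⟨⟨hT, hc⟩, hS.1.2⟩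
    simp [familyCounting, hc, hT]
  · intro S hS
    rw [Finset.mem_filter, Finset.mem_filter] at hS
    simp [familyCounting, hS.1.1, hS.1.2]

theorem IsCliqueFamily.counting_supp (h : IsCliqueFamily G A 𝒯) {S : Finset V}
    (hS : familyCounting G A 𝒯 S ≠ 0) : S ∈ 𝒯 := by
  by_contra hT
  have hc : S.card ≠ 1 := by
    intro hc
    obtain ⟨i, rfl⟩ := Finset.card_eq_one.1 hc
    exact hT (h.singleton i)
  exact hS (by simp [familyCounting, hc, hT])

/-- The sum of the counting numbers above a nonempty set of nodes. -/
theorem sum_familyCounting {S : Finset V} (hS : S.Nonempty) :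
    ∑ S' with S ⊆ S', familyCounting G A 𝒯 S' =
      (if S.card = 1 then 1 else 0) + ∑ S' ∈ 𝒯 with S ⊆ S', A.count (cliqueRegion G S') := by
  simp only [familyCounting]
  rw [Finset.sum_add_distrib]
  congr 1
  · have h1 : ∀ S' ∈ Finset.univ.filter (fun S' => S ⊆ S'),
        (if S'.card = 1 then (1 : ℤ) else 0) = if S' = S ∧ S.card = 1 then 1 else 0 := by
      intro S' hS'
      have hss := (Finset.mem_filter.1 hS').2
      refine if_congr ⟨fun h => ?_, fun h => h.1 ▸ h.2⟩ rfl rfl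
      have hle := Finset.card_le_card hss
      have hpos := Finset.card_pos.2 hS
      exact ⟨(Finset.eq_of_subset_of_card_le hss (by omega)).symm, by omega⟩
    rw [Finset.sum_congr rfl h1, sum_ite_subset]
    simp
  · rw [← Finset.sum_filter, Finset.filter_filter]
    refine Finset.sum_congr ?_ fun _ _ => rfl
    ext S'
    simp [and_comm]

end Families

/-! ### The size `n` clique approximation -/

section CliqueApprox

variable {V : Type*} [Fintype V] [DecidableEq V]

open scoped Classical in
/-- The nonempty cliques. -/
def nonemptyCliques (G : SimpleGraph V) : Finset (Finset V) :=
  Finset.univ.filter (fun S => S.Nonempty ∧ G.IsClique (S : Set V))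

theorem mem_nonemptyCliques {G : SimpleGraph V} {S : Finset V} :
    S ∈ nonemptyCliques G ↔ S.Nonempty ∧ G.IsClique (S : Set V) := by
  simp [nonemptyCliques]

theorem mem_cliquesUpTo_card {G : SimpleGraph V} {S : Finset V} :
    S ∈ cliquesUpTo G (Fintype.card V) ↔ G.IsClique (S : Set V) ∧ 1 < S.card := by
  simp only [cliquesUpTo, Finset.mem_filter, Finset.mem_univ, true_and]
  exact ⟨fun h => ⟨h.1, h.2.1⟩, fun h => ⟨h.1, h.2, Finset.card_le_univ S⟩⟩

theorem isCliqueFamily_cliqueApprox (G : SimpleGraph V) :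
    IsCliqueFamily G (cliqueApprox G (Fintype.card V)) (nonemptyCliques G) := by
  classical
  refine ⟨?_, fun S hS => mem_nonemptyCliques.1 hS, fun i => mem_nonemptyCliques.2 (by simp)⟩
  have h1 : nonemptyCliques G = Finset.univ.image (fun i => {i}) ∪
      cliquesUpTo G (Fintype.card V) := by
    ext S
    rw [mem_nonemptyCliques, Finset.mem_union, mem_cliquesUpTo_card, ← Finset.card_pos]
    simp only [Finset.mem_image, Finset.mem_univ, true_and]
    constructor
    · rintro ⟨h1, h2⟩
      rcases Nat.lt_or_ge 1 S.card with h3 | h3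
      · exact Or.inr ⟨h2, h3⟩
      · obtain ⟨i, rfl⟩ := Finset.card_eq_one.1 (by omega : S.card = 1)
        exact Or.inl ⟨i, rfl⟩
    · rintro (⟨i, rfl⟩ | ⟨h1, h2⟩)
      · simp
      · exact ⟨by omega, h1⟩
  rw [h1, Finset.image_union, Finset.image_image, ← Finset.union_assoc]
  simp only [Function.comp_def, cliqueRegion_singleton]
  simp only [cliqueApprox]

/-- The recursion makes the counting numbers above `S` add up to 1 if `S` has at least two nodes and
to 0 if it is a singleton; the singleton term of `familyCounting` supplies the missing 1. -/
theorem isCliqueCounting_cliqueApprox (G : SimpleGraph V) :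
    IsCliqueCounting G Finset.univ
      (familyCounting G (cliqueApprox G (Fintype.card V)) (nonemptyCliques G)) := by
  classical
  have hF := isCliqueFamily_cliqueApprox G
  refine ⟨fun S hS => ?_, fun S hne _ hS => ?_⟩
  · obtain ⟨h1, h2⟩ := hF.clique S (hF.counting_supp hS)
    exact ⟨h1, Finset.subset_univ _, h2⟩
  · have hcount : ∀ S', (cliqueApprox G (Fintype.card V)).count (cliqueRegion G S') =
        countingNumber (cliquesUpTo G (Fintype.card V)) (fun K => if 1 < K.card then 1 else 0)
          S' := by
      intro S'
      simp only [cliqueApprox]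
      rw [if_neg]
      · rfl
      · rintro ⟨i, hi⟩
        exact fRegion_ne_cliqueRegion G S' i hi.symm
    have hmem : S ∈ (nonemptyCliques G).filter (fun S' => S ⊆ S') := by
      simp [mem_nonemptyCliques, hne, hS]
    have hset : ((nonemptyCliques G).filter (fun S' => S ⊆ S')).erase S =
        (cliquesUpTo G (Fintype.card V)).filter (fun S' => S < S') := by
      ext S'
      rw [Finset.mem_erase, Finset.mem_filter, Finset.mem_filter, mem_nonemptyCliques,
        mem_cliquesUpTo_card]
      constructor
      · rintro ⟨h1, ⟨h2, h3⟩, h4⟩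
        have hss : S < S' := lt_of_le_of_ne h4 (Ne.symm h1)
        have := Finset.card_lt_card hss
        have := Finset.card_pos.2 hne
        exact ⟨⟨h3, by omega⟩, hss⟩
      · rintro ⟨⟨h1, h2⟩, h3⟩
        exact ⟨h3.ne', ⟨Finset.card_pos.1 (by omega), h1⟩, h3.le⟩
    rw [sum_familyCounting hne, ← Finset.add_sum_erase _ _ hmem, hset]
    simp only [hcount]
    rw [countingNumber_eq _ _ S]
    have := Finset.card_pos.2 hne
    have h3 : (if S.card = 1 then (1 : ℤ) else 0) + (if 1 < S.card then 1 else 0) = 1 := by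
      split_ifs <;> omega
    convert h3 using 2
    convert sub_add_cancel _ _

end CliqueApprox

/-! ### The Kikuchi construction: closure under nonempty intersections -/

section Levels

variable {V : Type*} [Fintype V] [DecidableEq V]

theorem mem_kikuchiCandidates {cur all : Finset (Region V)} {R : Region V} :
    R ∈ kikuchiCandidates cur all ↔ ∃ A ∈ cur, ∃ B ∈ all, A ⊓ B ≠ ⊥ ∧ ¬ A ≤ B ∧ ¬ B ≤ A ∧
      A ⊓ B = R := by
  simp only [kikuchiCandidates, Finset.mem_image, Finset.mem_filter, Finset.mem_product]
  constructor
  · rintro ⟨⟨A, B⟩, ⟨⟨hA, hB⟩, h1, h2, h3⟩, h4⟩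
    exact ⟨A, hA, B, hB, h1, h2, h3, h4⟩
  · rintro ⟨A, hA, B, hB, h1, h2, h3, h4⟩
    exact ⟨(A, B), ⟨⟨hA, hB⟩, h1, h2, h3⟩, h4⟩

theorem mem_kikuchiNext {cur all : Finset (Region V)} {R : Region V} :
    R ∈ kikuchiNext cur all ↔ R ∈ kikuchiCandidates cur all ∧
      ∀ R' ∈ kikuchiCandidates cur all, ¬ R < R' := by
  simp [kikuchiNext]

theorem exists_kikuchiNext_ge {cur all : Finset (Region V)} {R : Region V}
    (hR : R ∈ kikuchiCandidates cur all) : ∃ R' ∈ kikuchiNext cur all, R ≤ R' := by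
  obtain ⟨R', hle, hmax⟩ := (kikuchiCandidates cur all).exists_le_maximal hR
  exact ⟨R', mem_kikuchiNext.2 ⟨hmax.prop, fun R'' h => hmax.not_gt h⟩, hle⟩

variable {R₀ : Finset (Region V)}

theorem mem_kikuchiLevels_snd {n : ℕ} {R : Region V} :
    R ∈ (kikuchiLevels R₀ n).2 ↔ ∃ k ≤ n, R ∈ (kikuchiLevels R₀ k).1 := by
  induction n with
  | zero => simp [kikuchiLevels]
  | succ n ih =>
    have h : R ∈ (kikuchiLevels R₀ (n + 1)).2 ↔
        R ∈ (kikuchiLevels R₀ n).2 ∨ R ∈ (kikuchiLevels R₀ (n + 1)).1 := by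
      simp [kikuchiLevels]
    rw [h, ih]
    constructor
    · rintro (⟨k, hk, hR⟩ | hR)
      · exact ⟨k, by omega, hR⟩
      · exact ⟨n + 1, le_rfl, hR⟩
    · rintro ⟨k, hk, hR⟩
      rcases Nat.lt_or_ge n k with h1 | h1
      · obtain rfl : k = n + 1 := by omega
        exact Or.inr hR
      · exact Or.inl ⟨k, h1, hR⟩

theorem mem_kikuchiRegions {R : Region V} :
    R ∈ kikuchiRegions R₀ ↔ ∃ k, R ∈ (kikuchiLevels R₀ k).1 := by
  simp [kikuchiRegions]

theorem exists_gt_of_mem_kikuchiLevels {k : ℕ} {R : Region V}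
    (hR : R ∈ (kikuchiLevels R₀ (k + 1)).1) : ∃ A ∈ (kikuchiLevels R₀ k).1, R < A := by
  obtain ⟨A, hA, B, -, -, h1, -, rfl⟩ := mem_kikuchiCandidates.1 (mem_kikuchiNext.1 hR).1
  exact ⟨A, hA, lt_of_le_of_ne inf_le_left fun h => h1 (inf_eq_left.1 h)⟩

theorem exists_ge_of_mem_kikuchiLevels {k l : ℕ} (hlk : l ≤ k) {R : Region V}
    (hR : R ∈ (kikuchiLevels R₀ k).1) : ∃ A ∈ (kikuchiLevels R₀ l).1, R ≤ A := by
  induction k, hlk using Nat.le_induction generalizing R with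
  | base => exact ⟨R, hR, le_rfl⟩
  | succ k _ ih =>
    obtain ⟨A, hA, h⟩ := exists_gt_of_mem_kikuchiLevels hR
    obtain ⟨B, hB, h'⟩ := ih hA
    exact ⟨B, hB, h.le.trans h'⟩

/-- Each level lies strictly below the previous one, so a region loses an element per level. This
bounds the number of nonempty levels. -/
theorem card_add_le_of_mem_kikuchiLevels {k : ℕ} {R : Region V}
    (hR : R ∈ (kikuchiLevels R₀ k).1) :
    R.1.card + R.2.card + k ≤ Fintype.card V + Fintype.card (V ⊕ Sym2 V) := by
  induction k generalizing R with
  | zero =>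
    have := Finset.card_le_univ R.1
    have := Finset.card_le_univ R.2
    omega
  | succ k ih =>
    obtain ⟨A, hA, h⟩ := exists_gt_of_mem_kikuchiLevels hR
    have h1 := ih hA
    rcases Prod.lt_iff.1 h with ⟨h2, h3⟩ | ⟨h2, h3⟩
    · have := Finset.card_lt_card h2
      have := Finset.card_le_card h3
      omega
    · have := Finset.card_lt_card h3
      have := Finset.card_le_card h2
      omega

/-- A region is never properly contained in a region of a later level. -/
theorem not_lt_of_mem_kikuchiLevels
    (h0 : ∀ Q ∈ R₀, ∀ A ∈ R₀, ∀ S, ¬ (Q < S ∧ S < A)) {l m : ℕ} (hlm : l ≤ m) (hm : 1 ≤ m)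
    {Q S : Region V} (hQ : Q ∈ (kikuchiLevels R₀ l).1) (hS : S ∈ (kikuchiLevels R₀ m).1) :
    ¬ Q < S := by
  intro hQS
  cases l with
  | zero =>
    obtain ⟨m, rfl⟩ : ∃ m', m = m' + 1 := ⟨m - 1, by omega⟩
    obtain ⟨B, hB, hSB⟩ := exists_gt_of_mem_kikuchiLevels hS
    obtain ⟨A, hA, hBA⟩ := exists_ge_of_mem_kikuchiLevels (Nat.zero_le m) hB
    exact h0 Q hQ A hA S ⟨hQS, hSB.trans_le hBA⟩
  | succ l =>
    obtain ⟨A, hA, hSA⟩ := exists_ge_of_mem_kikuchiLevels hlm hS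
    -- `S` lies below a region `A` of the level of `Q`, and `Q < A` contradicts the maximality of
    -- `Q` among the candidates of that level.
    exact (mem_kikuchiNext.1 hQ).2 A (mem_kikuchiNext.1 hA).1 (hQS.trans_le hSA)

/-- The regions of a Kikuchi approximation are closed under nonempty intersections. -/
theorem inf_mem_kikuchiRegions
    (h0 : ∀ Q ∈ R₀, ∀ A ∈ R₀, ∀ S, ¬ (Q < S ∧ S < A)) {A B : Region V}
    (hA : A ∈ kikuchiRegions R₀) (hB : B ∈ kikuchiRegions R₀) (hne : A ⊓ B ≠ ⊥) :
    A ⊓ B ∈ kikuchiRegions R₀ := by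
  by_cases hAB : A ≤ B
  · rwa [inf_eq_left.2 hAB]
  by_cases hBA : B ≤ A
  · rwa [inf_eq_right.2 hBA]
  by_contra hnot
  obtain ⟨a, ha⟩ := mem_kikuchiRegions.1 hA
  obtain ⟨b, hb⟩ := mem_kikuchiRegions.1 hB
  have hup : ∀ n, A ⊓ B ∈ kikuchiCandidates (kikuchiLevels R₀ n).1 (kikuchiLevels R₀ n).2 →
      ∃ S ∈ (kikuchiLevels R₀ (n + 1)).1, A ⊓ B < S := by
    intro n hn
    obtain ⟨S, hS, hle⟩ := exists_kikuchiNext_ge hn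
    refine ⟨S, hS, lt_of_le_of_ne hle ?_⟩
    rintro rfl
    exact hnot (mem_kikuchiRegions.2 ⟨n + 1, hS⟩)
  -- If `A ⊓ B` were missing, every later level would contain a region `S` strictly above it,
  -- contrary to the bound on levels. Such an `S` is not below both `A` and `B`; met with one it is
  -- not below, it gives a candidate for the next level that is still above `A ⊓ B`.
  have hlev : ∀ n, ∃ S ∈ (kikuchiLevels R₀ (max a b + 1 + n)).1, A ⊓ B < S := by
    intro n
    induction n with
    | zero =>
      apply hup
      rw [mem_kikuchiCandidates]
      rcases le_total a b with h | h
      · rw [max_eq_right h]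
        exact ⟨B, hb, A, mem_kikuchiLevels_snd.2 ⟨a, h, ha⟩, by rwa [inf_comm], hBA, hAB,
          inf_comm _ _⟩
      · rw [max_eq_left h]
        exact ⟨A, ha, B, mem_kikuchiLevels_snd.2 ⟨b, h, hb⟩, hne, hAB, hBA, rfl⟩
    | succ n ih =>
      obtain ⟨S, hS, hlt⟩ := ih
      have hstep : ∀ q Q, q ≤ max a b → Q ∈ (kikuchiLevels R₀ q).1 → A ⊓ B ≤ Q → ¬ S ≤ Q →
          ∃ S' ∈ (kikuchiLevels R₀ (max a b + 1 + n + 1)).1, A ⊓ B < S' := by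
        intro q Q hq hQ hle hSQ
        have hQS : ¬ Q ≤ S := by
          intro h
          rcases h.lt_or_eq with h | h
          · exact not_lt_of_mem_kikuchiLevels h0 (by omega) (by omega) hQ hS h
          · exact hSQ h.ge
        have hge : A ⊓ B ≤ S ⊓ Q := le_inf hlt.le hle
        have hcand : S ⊓ Q ∈ kikuchiCandidates (kikuchiLevels R₀ (max a b + 1 + n)).1
            (kikuchiLevels R₀ (max a b + 1 + n)).2 :=
          mem_kikuchiCandidates.2 ⟨S, hS, Q, mem_kikuchiLevels_snd.2 ⟨q, by omega, hQ⟩,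
            fun h => hne (le_bot_iff.1 (h ▸ hge)), hSQ, hQS, rfl⟩
        obtain ⟨S', hS', hle'⟩ := exists_kikuchiNext_ge hcand
        refine ⟨S', hS', lt_of_le_of_ne (hge.trans hle') ?_⟩
        rintro rfl
        exact hnot (mem_kikuchiRegions.2 ⟨max a b + 1 + n + 1, hS'⟩)
      by_cases hSA : S ≤ A
      · exact hstep b B (le_max_right _ _) hb inf_le_right
          fun hSB => hlt.not_ge (le_inf hSA hSB)
      · exact hstep a A (le_max_left _ _) ha inf_le_left hSA
  obtain ⟨S, hS, -⟩ := hlev (Fintype.card V + Fintype.card (V ⊕ Sym2 V))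
  have := card_add_le_of_mem_kikuchiLevels hS
  omega

end Levels

/-! ### The maximal-clique Kikuchi approximation -/

section MaxCliqueKikuchi

variable {V : Type*} [Fintype V] [DecidableEq V]

theorem mem_maxCliques {G : SimpleGraph V} {K : Finset V} :
    K ∈ maxCliques G ↔ Maximal (fun K : Finset V => G.IsClique (K : Set V)) K := by
  simp [maxCliques]

theorem exists_maxClique_ge {G : SimpleGraph V} {S : Finset V} (hS : G.IsClique (S : Set V)) :
    ∃ K ∈ maxCliques G, S ⊆ K := by
  obtain ⟨K, hle, hmax⟩ :=
    (Set.toFinite {K : Finset V | G.IsClique (K : Set V)}).exists_le_maximal hS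
  exact ⟨K, mem_maxCliques.2 hmax, hle⟩

theorem maxCliques_nonempty [Nonempty V] {G : SimpleGraph V} {K : Finset V}
    (hK : K ∈ maxCliques G) : K.Nonempty := by
  rw [Finset.nonempty_iff_ne_empty]
  rintro rfl
  have h := (mem_maxCliques.1 hK).2 (y := {Classical.arbitrary V}) (by simp) (by simp)
  simpa using h (Finset.mem_singleton_self _)

/-- The regions `R_{f_i}` and the regions of the maximal cliques. -/
def maxCliqueBase (G : SimpleGraph V) : Finset (Region V) :=
  Finset.univ.image fRegion ∪ (maxCliques G).image (cliqueRegion G)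

theorem mem_maxCliqueBase {G : SimpleGraph V} {R : Region V} :
    R ∈ maxCliqueBase G ↔ (∃ i, fRegion i = R) ∨ ∃ K ∈ maxCliques G, cliqueRegion G K = R := by
  simp [maxCliqueBase]

/-- The base need not be an antichain: for an isolated node `i`, the clique region of `{i}` is
`xRegion i`, which is properly contained in `fRegion i`. But nothing lies between these two, and no
base region lies strictly below a maximal clique region. -/
theorem maxCliqueBase_not_lt_lt [Nonempty V] {G : SimpleGraph V} (Q : Region V)
    (hQ : Q ∈ maxCliqueBase G) (A : Region V) (hA : A ∈ maxCliqueBase G) (S : Region V) :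
    ¬ (Q < S ∧ S < A) := by
  rintro ⟨hQS, hSA⟩
  rcases mem_maxCliqueBase.1 hA with ⟨i, rfl⟩ | ⟨K, hK, rfl⟩
  · have hQ1 : Q.1.Nonempty := by
      rcases mem_maxCliqueBase.1 hQ with ⟨j, rfl⟩ | ⟨K, hK, rfl⟩
      · exact Finset.singleton_nonempty j
      · exact maxCliques_nonempty hK
    have hs : ∀ T : Finset V, T.Nonempty → T ≤ {i} → T = {i} := fun T hT h =>
      (Finset.subset_singleton_iff.1 h).resolve_left hT.ne_empty
    have h1 : Q.1 = {i} := hs _ hQ1 (hQS.le.1.trans hSA.le.1)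
    have h2 : S.1 = {i} := hs _ (hQ1.mono hQS.le.1) hSA.le.1
    rcases Finset.subset_singleton_iff.1 (show S.2 ⊆ {Sum.inl i} from hSA.le.2) with h3 | h3
    · have h4 : Q.2 = ∅ := Finset.subset_empty.1 (h3 ▸ hQS.le.2)
      exact hQS.ne (Prod.ext (h1.trans h2.symm) (h4.trans h3.symm))
    · exact hSA.ne (Prod.ext h2 h3)
  · rcases mem_maxCliqueBase.1 hQ with ⟨j, rfl⟩ | ⟨K', hK', rfl⟩
    · exact not_fRegion_le_cliqueRegion G K j (hQS.trans hSA).le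
    · have hle := cliqueRegion_le_iff.1 (hQS.trans hSA).le
      have heq : K' = K := hle.antisymm ((mem_maxCliques.1 hK').2 (mem_maxCliques.1 hK).1 hle)
      subst heq
      exact lt_irrefl _ (hQS.trans hSA)

open scoped Classical in
/-- The sets of nodes of the regions `R(S)` of the Kikuchi approximation. -/
def kikuchiFamily (G : SimpleGraph V) : Finset (Finset V) :=
  Finset.univ.filter (fun S => cliqueRegion G S ∈ kikuchiRegions (maxCliqueBase G))

theorem mem_kikuchiFamily {G : SimpleGraph V} {S : Finset V} :
    S ∈ kikuchiFamily G ↔ cliqueRegion G S ∈ kikuchiRegions (maxCliqueBase G) := by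
  simp [kikuchiFamily]

theorem maxCliqueBase_subset (G : SimpleGraph V) :
    maxCliqueBase G ⊆ kikuchiRegions (maxCliqueBase G) :=
  fun _ h => mem_kikuchiRegions.2 ⟨0, h⟩

theorem fRegion_inf_cliqueRegion (G : SimpleGraph V) (i : V) (S : Finset V) :
    fRegion i ⊓ cliqueRegion G S = ({i} ∩ S, ∅) := by
  refine Prod.ext rfl ?_
  change {Sum.inl i} ∩ (cliqueRegion G S).2 = ∅
  exact Finset.singleton_inter_of_notMem (inl_notMem_cliqueRegion G S i)

theorem xRegion_ne_bot (i : V) : xRegion i ≠ (⊥ : Region V) :=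
  fun h => Finset.singleton_ne_empty i (congrArg Prod.fst h)

theorem fRegion_inf_cliqueRegion_of_mem (G : SimpleGraph V) {i : V} {S : Finset V} (hi : i ∈ S) :
    fRegion i ⊓ cliqueRegion G S = xRegion i := by
  rw [fRegion_inf_cliqueRegion, Finset.singleton_inter_of_mem hi, xRegion]

theorem fRegion_inf_cliqueRegion_of_notMem (G : SimpleGraph V) {i : V} {S : Finset V}
    (hi : i ∉ S) : fRegion i ⊓ cliqueRegion G S = ⊥ := by
  rw [fRegion_inf_cliqueRegion, Finset.singleton_inter_of_notMem hi]
  rfl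

/-- Two distinct `fRegion`s are disjoint, an `fRegion` meets a clique region in nothing or in the
clique region of a singleton, and two clique regions meet in a clique region. -/
theorem kikuchiRegions_cases [Nonempty V] {G : SimpleGraph V} {R : Region V}
    (hR : R ∈ kikuchiRegions (maxCliqueBase G)) :
    (∃ i, fRegion i = R) ∨
      ∃ S : Finset V, S.Nonempty ∧ G.IsClique (S : Set V) ∧ cliqueRegion G S = R := by
  obtain ⟨k, hk⟩ := mem_kikuchiRegions.1 hR
  clear hR
  induction k using Nat.strong_induction_on generalizing R with
  | _ k ih =>
  cases k with
  | zero =>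
    rcases mem_maxCliqueBase.1 hk with h | ⟨K, hK, rfl⟩
    · exact Or.inl h
    · exact Or.inr ⟨K, maxCliques_nonempty hK, (mem_maxCliques.1 hK).1, rfl⟩
  | succ k =>
    obtain ⟨A, hA, B, hB, hne, h1, h2, rfl⟩ :=
      mem_kikuchiCandidates.1 (mem_kikuchiNext.1 hk).1
    obtain ⟨l, hl, hB⟩ := mem_kikuchiLevels_snd.1 hB
    have hx : ∀ i S, fRegion i ⊓ cliqueRegion G S ≠ ⊥ → ∃ S' : Finset V, S'.Nonempty ∧
        G.IsClique (S' : Set V) ∧ cliqueRegion G S' = fRegion i ⊓ cliqueRegion G S := by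
      intro i S h
      by_cases hi : i ∈ S
      · refine ⟨{i}, by simp, by simp, ?_⟩
        rw [cliqueRegion_singleton, fRegion_inf_cliqueRegion_of_mem G hi]
      · exact (h (fRegion_inf_cliqueRegion_of_notMem G hi)).elim
    right
    rcases ih k (by omega) hA with ⟨i, rfl⟩ | ⟨S, hS, hSc, rfl⟩ <;>
      rcases ih l (by omega) hB with ⟨j, rfl⟩ | ⟨S', hS', hSc', rfl⟩
    · have hij : i ≠ j := fun h => h1 (by rw [h])
      refine (hne ?_).elim
      refine Prod.ext ?_ ?_
      · exact Finset.singleton_inter_of_notMem (by simpa [fRegion] using hij)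
      · exact Finset.singleton_inter_of_notMem (by simpa [fRegion] using hij)
    · exact hx i S' hne
    · rw [inf_comm] at hne ⊢
      exact hx j S hne
    · rw [cliqueRegion_inf] at hne ⊢
      refine ⟨S ∩ S', ?_, hSc.subset (by simp), rfl⟩
      rw [Finset.nonempty_iff_ne_empty]
      intro h
      rw [h] at hne
      refine hne (Prod.ext rfl ?_)
      classical
      simp only [cliqueRegion, Prod.snd_bot, Finset.bot_eq_empty, Finset.image_eq_empty]
      rw [Finset.filter_eq_empty_iff]
      rintro e - ⟨-, he⟩
      induction e with
      | _ a b => simpa using he a (by simp)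

theorem isCliqueFamily_maxCliqueKikuchi [Nonempty V] (G : SimpleGraph V) :
    IsCliqueFamily G (maxCliqueKikuchi G) (kikuchiFamily G) := by
  refine ⟨?_, fun S hS => ?_, fun i => ?_⟩
  · change kikuchiRegions (maxCliqueBase G) = _
    ext R
    simp only [Finset.mem_union, Finset.mem_image, Finset.mem_univ, true_and, mem_kikuchiFamily]
    constructor
    · intro hR
      rcases kikuchiRegions_cases hR with h | ⟨S, -, -, rfl⟩
      · exact Or.inl h
      · exact Or.inr ⟨S, hR, rfl⟩
    · rintro (h | ⟨S, hS, rfl⟩)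
      · exact maxCliqueBase_subset G (mem_maxCliqueBase.2 (Or.inl h))
      · exact hS
  · rcases kikuchiRegions_cases (mem_kikuchiFamily.1 hS) with ⟨i, h⟩ | ⟨S', h1, h2, h3⟩
    · exact (fRegion_ne_cliqueRegion G S i h).elim
    · rw [← cliqueRegion_injective G h3]
      exact ⟨h1, h2⟩
  · obtain ⟨K, hK, hiK⟩ := exists_maxClique_ge (G := G) (S := {i}) (by simp)
    -- `R_{x_i}` arises as the intersection of `R_{f_i}` with the region of a maximal clique through
    -- `i`.
    have h := fRegion_inf_cliqueRegion_of_mem G (Finset.singleton_subset_iff.1 hiK)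
    rw [mem_kikuchiFamily, cliqueRegion_singleton, ← h]
    refine inf_mem_kikuchiRegions (fun Q hQ A hA S => maxCliqueBase_not_lt_lt Q hQ A hA S)
      (maxCliqueBase_subset G (mem_maxCliqueBase.2 (Or.inl ⟨i, rfl⟩)))
      (maxCliqueBase_subset G (mem_maxCliqueBase.2 (Or.inr ⟨K, hK, rfl⟩))) ?_
    rw [h]
    exact xRegion_ne_bot i

theorem inter_mem_kikuchiFamily [Nonempty V] {G : SimpleGraph V} {S S' : Finset V}
    (hS : S ∈ kikuchiFamily G) (hS' : S' ∈ kikuchiFamily G) (hne : (S ∩ S').Nonempty) :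
    S ∩ S' ∈ kikuchiFamily G := by
  rw [mem_kikuchiFamily] at *
  rw [← cliqueRegion_inf]
  refine inf_mem_kikuchiRegions (fun Q hQ A hA S => maxCliqueBase_not_lt_lt Q hQ A hA S) hS hS' ?_
  rw [cliqueRegion_inf]
  intro h
  exact hne.ne_empty (congrArg Prod.fst h)

/-- The smallest member of the family that contains a given nonempty clique. -/
theorem exists_closure_mem_kikuchiFamily [Nonempty V] {G : SimpleGraph V} {S : Finset V}
    (hne : S.Nonempty) (hS : G.IsClique (S : Set V)) :
    ∃ C ∈ kikuchiFamily G, S ⊆ C ∧ ∀ S' ∈ kikuchiFamily G, S ⊆ S' → C ⊆ S' := by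
  have hex : ((kikuchiFamily G).filter (fun S' => S ⊆ S')).Nonempty := by
    obtain ⟨K, hK, hSK⟩ := exists_maxClique_ge hS
    exact ⟨K, Finset.mem_filter.2 ⟨mem_kikuchiFamily.2
      (maxCliqueBase_subset G (mem_maxCliqueBase.2 (Or.inr ⟨K, hK, rfl⟩))), hSK⟩⟩
  obtain ⟨C, hC, hmin⟩ := Finset.exists_min_image _ Finset.card hex
  rw [Finset.mem_filter] at hC
  refine ⟨C, hC.1, hC.2, fun S' hS' hSS' => ?_⟩
  have hsub : S ⊆ C ∩ S' := Finset.subset_inter hC.2 hSS'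
  have h1 := hmin (C ∩ S')
    (Finset.mem_filter.2 ⟨inter_mem_kikuchiFamily hC.1 hS' (hne.mono hsub), hsub⟩)
  rw [← Finset.eq_of_subset_of_card_le Finset.inter_subset_left h1]
  exact Finset.inter_subset_right

theorem kikuchi_count_sum {R₀ : Finset (Region V)} {R : Region V} (hR : R ∈ kikuchiRegions R₀) :
    ∑ R' ∈ kikuchiRegions R₀ with R ≤ R', (kikuchiApprox R₀).count R' = 1 := by
  classical
  have hmem : R ∈ (kikuchiRegions R₀).filter (fun R' => R ≤ R') := by simp [hR]
  rw [← Finset.add_sum_erase _ _ hmem]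
  have hset : ((kikuchiRegions R₀).filter (fun R' => R ≤ R')).erase R =
      (kikuchiRegions R₀).filter (fun R' => R < R') := by
    ext R'
    simp only [Finset.mem_erase, Finset.mem_filter, lt_iff_le_and_ne]
    tauto
  rw [hset]
  simp only [kikuchiApprox]
  rw [countingNumber_eq _ _ R]
  convert sub_add_cancel _ _

/-- The members of the family above `S` are those above its closure `C`, so the sum at `S` is the
sum at `C`, where the defining recursion applies. A region `R_{f_i}` lies above the region of `C`
only if `C = {i}`; its counting number 1 is the singleton term of `familyCounting`. -/
theorem isCliqueCounting_maxCliqueKikuchi [Nonempty V] (G : SimpleGraph V) :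
    IsCliqueCounting G Finset.univ
      (familyCounting G (maxCliqueKikuchi G) (kikuchiFamily G)) := by
  have hF := isCliqueFamily_maxCliqueKikuchi G
  refine ⟨fun S hS => ?_, fun S hne _ hS => ?_⟩
  · obtain ⟨h1, h2⟩ := hF.clique S (hF.counting_supp hS)
    exact ⟨h1, Finset.subset_univ _, h2⟩
  obtain ⟨C, hC, hSC, hmin⟩ := exists_closure_mem_kikuchiFamily hne hS
  have hCne := (hF.clique C hC).1
  have hred : ∑ S' with S ⊆ S', familyCounting G (maxCliqueKikuchi G) (kikuchiFamily G) S' =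
      ∑ S' with C ⊆ S', familyCounting G (maxCliqueKikuchi G) (kikuchiFamily G) S' := by
    symm
    refine Finset.sum_subset ?_ ?_
    · intro S' hS'
      simp only [Finset.mem_filter, Finset.mem_univ, true_and] at hS' ⊢
      exact hSC.trans hS'
    · intro S' hS' hCS'
      simp only [Finset.mem_filter, Finset.mem_univ, true_and] at hS' hCS'
      by_contra h
      exact hCS' (hmin S' (hF.counting_supp h) hS')
  rw [hred, sum_familyCounting hCne]
  have hsum := kikuchi_count_sum (mem_kikuchiFamily.1 hC)
  have hregions : kikuchiRegions (maxCliqueBase G) =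
      Finset.univ.image fRegion ∪ (kikuchiFamily G).image (cliqueRegion G) := hF.regions_eq
  have hdisj : Disjoint ((Finset.univ.image fRegion).filter (fun R' => cliqueRegion G C ≤ R'))
      (((kikuchiFamily G).image (cliqueRegion G)).filter (fun R' => cliqueRegion G C ≤ R')) := by
    refine Finset.disjoint_filter_filter (Finset.disjoint_left.2 ?_)
    intro R h1 h2
    obtain ⟨i, -, rfl⟩ := Finset.mem_image.1 h1
    obtain ⟨S', -, h⟩ := Finset.mem_image.1 h2
    exact fRegion_ne_cliqueRegion G S' i h.symm
  have hcount : ∀ i, (maxCliqueKikuchi G).count (fRegion i) = 1 := by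
    intro i
    classical
    change countingNumber (kikuchiRegions (maxCliqueBase G)) (fun _ => 1) (fRegion i) = 1
    rw [countingNumber_eq, Finset.sum_eq_zero, sub_zero]
    intro R hR
    rw [Finset.mem_filter] at hR
    exfalso
    rcases kikuchiRegions_cases hR.1 with ⟨j, rfl⟩ | ⟨S', -, -, rfl⟩
    · have h : i = j := by simpa [fRegion] using hR.2.le.1
      exact hR.2.ne (by rw [h])
    · exact not_fRegion_le_cliqueRegion G S' i hR.2.le
  have hf : ∑ R' ∈ (Finset.univ.image fRegion).filter (fun R' => cliqueRegion G C ≤ R'),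
      (maxCliqueKikuchi G).count R' = if C.card = 1 then 1 else 0 := by
    rw [Finset.filter_image, Finset.sum_image fRegion_injective.injOn,
      Finset.sum_congr rfl (fun i _ => hcount i)]
    split_ifs with hc
    · obtain ⟨i, rfl⟩ := Finset.card_eq_one.1 hc
      rw [Finset.sum_eq_single_of_mem i]
      · rw [Finset.mem_filter, cliqueRegion_singleton]
        exact ⟨Finset.mem_univ _, le_rfl, Finset.empty_subset _⟩
      · intro j hj hji
        have h : i = j := by simpa [fRegion, cliqueRegion] using (Finset.mem_filter.1 hj).2.1
        exact (hji h.symm).elim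
    · refine Finset.sum_eq_zero fun i hi => ?_
      have h : C ⊆ {i} := (Finset.mem_filter.1 hi).2.1
      have h1 := Finset.card_le_card h
      have h2 := Finset.card_pos.2 hCne
      rw [Finset.card_singleton] at h1
      omega
  have hk : ∑ R' ∈ ((kikuchiFamily G).image (cliqueRegion G)).filter
      (fun R' => cliqueRegion G C ≤ R'), (maxCliqueKikuchi G).count R' =
      ∑ S' ∈ kikuchiFamily G with C ⊆ S', (maxCliqueKikuchi G).count (cliqueRegion G S') := by
    rw [Finset.filter_image, Finset.sum_image (cliqueRegion_injective G).injOn]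
    refine Finset.sum_congr ?_ fun _ _ => rfl
    ext S'
    rw [Finset.mem_filter, Finset.mem_filter, cliqueRegion_le_iff]
  rw [← hf, ← hk, ← Finset.sum_union hdisj, ← Finset.filter_union, ← hregions]
  exact hsum

end MaxCliqueKikuchi

/-! ### Clique trees and the closed formula -/

section CliqueTree

/-- In a tree, a nonempty intersection of subtrees is a subtree. -/
theorem isTree_induce_of_forall {X ι : Type*} {T : SimpleGraph X} (hT : T.IsTree) {S : Set ι}
    {A : ι → Set X} (hA : ∀ v ∈ S, (T.induce (A v)).IsTree) {B : Set X}
    (hB : ∀ K, K ∈ B ↔ ∀ v ∈ S, K ∈ A v) (hne : B.Nonempty) : (T.induce B).IsTree := by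
  classical
  have hpre : (T.induce B).Preconnected := by
    rintro ⟨K, hK⟩ ⟨K', hK'⟩
    -- Paths in `T` are unique, so the path from `K` to `K'` runs inside each of the subtrees.
    obtain ⟨P, hP⟩ := (hT.connected.preconnected K K').exists_isPath
    have hPB : ∀ w ∈ P.support, w ∈ B := by
      intro w hw
      rw [hB]
      intro v hv
      obtain ⟨Q, hQ⟩ := ((hA v hv).connected.preconnected ⟨K, (hB K).1 hK v hv⟩
        ⟨K', (hB K').1 hK' v hv⟩).exists_isPath
      have hQ' : (Q.map (SimpleGraph.Embedding.induce (A v)).toHom).IsPath :=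
        hQ.map (SimpleGraph.Embedding.induce (G := T) (A v)).injective
      have heq := (hT.isAcyclic.subsingleton_path K K').elim ⟨P, hP⟩ ⟨_, hQ'⟩
      have hPQ : P = Q.map (SimpleGraph.Embedding.induce (A v)).toHom := congrArg Subtype.val heq
      rw [hPQ] at hw
      obtain ⟨u, -, rfl⟩ := List.mem_map.1 ((congrArg (w ∈ ·)
        (SimpleGraph.Walk.support_map (SimpleGraph.Embedding.induce (A v)).toHom Q)).mp hw)
      exact u.2
    exact ⟨P.induce B hPB⟩
  have : Nonempty B := hne.to_subtype
  exact ⟨⟨hpre⟩, hT.isAcyclic.induce B⟩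

variable {V : Type*} [Fintype V] [DecidableEq V] {G : SimpleGraph V}
  {T : SimpleGraph {K : Finset V // K ∈ maxCliques G}}

theorem subset_separator {S : Finset V} {e : Sym2 {K : Finset V // K ∈ maxCliques G}} :
    S ⊆ separator G e ↔ ∀ K ∈ e, S ⊆ K.1 := by
  induction e with
  | _ K K' => simp [separator, Finset.subset_inter_iff]

open scoped Classical in
/-- The number of edges of `T` with separator `S`. -/
def separatorCount (T : SimpleGraph {K : Finset V // K ∈ maxCliques G}) (S : Finset V) : ℕ :=
  (Finset.univ.filter (fun e => e ∈ T.edgeSet ∧ separator G e = S)).card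

/-- The counting numbers of a clique tree: the maximal cliques are counted positively and the
separators negatively. -/
def treeCounting (T : SimpleGraph {K : Finset V // K ∈ maxCliques G}) (S : Finset V) : ℤ :=
  if S.Nonempty then (if S ∈ maxCliques G then 1 else 0) - (separatorCount T S : ℤ) else 0

-- The maximal cliques containing `S` form the intersection of the subtrees of the nodes of `S`,
-- hence a subtree. Its edges are those whose separator contains `S`, one fewer than its nodes.
open scoped Classical in
theorem IsCliqueTree.card_eq (hT : IsCliqueTree G T) {S : Finset V}
    (hS : G.IsClique (S : Set V)) :
    (Finset.univ.filter (fun e => e ∈ T.edgeSet ∧ S ⊆ separator G e)).card + 1 =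
      ((maxCliques G).filter (fun K => S ⊆ K)).card := by
  classical
  let B : Set {K : Finset V // K ∈ maxCliques G} := {K | S ⊆ K.1}
  have htree : (T.induce B).IsTree := by
    refine isTree_induce_of_forall hT.1 (S := (S : Set V)) (A := fun v => {K | v ∈ K.1})
      (fun v _ => hT.2 v) (fun K => Iff.rfl) ?_
    obtain ⟨K, hK, hSK⟩ := exists_maxClique_ge hS
    exact ⟨⟨K, hK⟩, hSK⟩
  have h1 := htree.card_edgeFinset
  have h2 := congrArg Finset.card (SimpleGraph.map_edgeFinset_induce (G := T) (s := B))
  rw [Finset.card_map] at h2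
  have h3 : T.edgeFinset ∩ B.toFinset.sym2 =
      Finset.univ.filter (fun e => e ∈ T.edgeSet ∧ S ⊆ separator G e) := by
    ext e
    simp only [Finset.mem_inter, SimpleGraph.mem_edgeFinset, Finset.mem_sym2_iff, Set.mem_toFinset,
      Finset.mem_filter, Finset.mem_univ, true_and, subset_separator]
    rfl
  have h4 : Fintype.card B = ((maxCliques G).filter (fun K => S ⊆ K)).card := by
    rw [Fintype.card_subtype, ← Finset.card_map (Function.Embedding.subtype _)]
    congr 1
    ext K
    simp [B, and_comm]
  rw [← h3, ← h4, ← h1]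
  congr 1
  convert h2.symm

/-- The sum at `S` counts nodes minus edges of the subtree above `S`. Empty separators, which occur
when the graph is disconnected, are dropped by `treeCounting`; they contain no nonempty `S`. -/
theorem IsCliqueTree.isCliqueCounting (hT : IsCliqueTree G T) :
    IsCliqueCounting G Finset.univ (treeCounting T) := by
  classical
  refine ⟨fun S hS => ?_, fun S hne _ hS => ?_⟩
  · by_cases hne : S.Nonempty
    · refine ⟨hne, Finset.subset_univ _, ?_⟩
      by_cases hK : S ∈ maxCliques G
      · exact (mem_maxCliques.1 hK).1
      · have hpos : separatorCount T S ≠ 0 := by simpa [treeCounting, hne, hK] using hS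
        obtain ⟨e, he⟩ := Finset.card_pos.1 (Nat.pos_of_ne_zero hpos)
        obtain ⟨-, rfl⟩ := (Finset.mem_filter.1 he).2
        obtain ⟨K, hKe⟩ : ∃ K, K ∈ e := ⟨_, e.out_fst_mem⟩
        exact (mem_maxCliques.1 K.2).1.subset
          (Finset.coe_subset.2 (subset_separator.1 subset_rfl K hKe))
    · exact (hS (by simp [treeCounting, hne])).elim
  · have h1 : ∀ S' ∈ Finset.univ.filter (fun S' => S ⊆ S'), treeCounting T S' =
        (if S' ∈ maxCliques G then 1 else 0) - (separatorCount T S' : ℤ) := by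
      intro S' hS'
      exact if_pos (hne.mono (Finset.mem_filter.1 hS').2)
    have h2 : ∑ S' with S ⊆ S', separatorCount T S' =
        (Finset.univ.filter (fun e => e ∈ T.edgeSet ∧ S ⊆ separator G e)).card := by
      rw [Finset.card_eq_sum_card_fiberwise (f := separator G)
        (t := Finset.univ.filter (fun S' => S ⊆ S'))]
      · refine Finset.sum_congr rfl fun S' hS' => ?_
        rw [separatorCount, Finset.filter_filter]
        congr 1
        ext e
        simp only [Finset.mem_filter, Finset.mem_univ, true_and] at hS' ⊢
        constructor
        · rintro ⟨h, rfl⟩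
          exact ⟨⟨h, hS'⟩, rfl⟩
        · rintro ⟨⟨h, -⟩, h'⟩
          exact ⟨h, h'⟩
      · intro e he
        simp only [Finset.coe_filter, Finset.mem_univ, true_and, Set.mem_ofPred_eq] at he ⊢
        exact he.2
    have h3 : ∑ S' with S ⊆ S', (if S' ∈ maxCliques G then (1 : ℤ) else 0) =
        ((maxCliques G).filter (fun K => S ⊆ K)).card := by
      rw [← Finset.sum_filter, Finset.filter_filter, Finset.sum_const, nsmul_eq_mul, mul_one]
      congr 2
      ext S'
      simp [and_comm]
    rw [Finset.sum_congr rfl h1, Finset.sum_sub_distrib, ← Nat.cast_sum, h2, h3,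
      ← hT.card_eq hS]
    push_cast
    ring

/-- Several edges can share a separator, so the product over edges is grouped by separator;
`separatorCount` is the resulting exponent. -/
theorem cliqueRate_treeCounting (T : SimpleGraph {K : Finset V // K ∈ maxCliques G}) {φ : V → ℝ}
    (hlt : ∀ S : Finset V, G.IsClique (S : Set V) → ∑ s ∈ S, φ s < 1) (i : V) :
    cliqueRate (treeCounting T) φ i = chordalRate G T φ i := by
  classical
  have hpt : ∀ S ∈ Finset.univ.filter (fun S : Finset V => i ∈ S),
      (1 - ∑ s ∈ S, φ s) ^ (-treeCounting T S) = (1 - ∑ s ∈ S, φ s) ^ separatorCount T S *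
        if S ∈ maxCliques G then (1 - ∑ s ∈ S, φ s)⁻¹ else 1 := by
    intro S hS
    have hne : S.Nonempty := ⟨i, (Finset.mem_filter.1 hS).2⟩
    by_cases hK : S ∈ maxCliques G
    · have h0 : 1 - ∑ s ∈ S, φ s ≠ 0 := by linarith [hlt S (mem_maxCliques.1 hK).1]
      simp only [treeCounting, hne, hK, if_true]
      rw [show -(1 - (separatorCount T S : ℤ)) = separatorCount T S + -1 by ring, zpow_add₀ h0,
        zpow_natCast, zpow_neg_one]
    · simp [treeCounting, hne, hK]
  rw [cliqueRate, chordalRate, Finset.prod_congr rfl hpt, Finset.prod_mul_distrib, mul_div_assoc,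
    div_eq_mul_inv]
  congr 2
  · rw [← Finset.prod_fiberwise_of_maps_to (g := separator G)
      (t := Finset.univ.filter (fun S : Finset V => i ∈ S))]
    · refine Finset.prod_congr rfl fun S hS => ?_
      have hiS := (Finset.mem_filter.1 hS).2
      rw [Finset.prod_congr rfl (g := fun _ => 1 - ∑ s ∈ S, φ s), Finset.prod_const, separatorCount,
        Finset.filter_filter]
      · congr 2
        ext e
        simp only [Finset.mem_filter, Finset.mem_univ, true_and]
        constructor
        · rintro ⟨h, rfl⟩
          exact ⟨⟨h, hiS⟩, rfl⟩
        · rintro ⟨⟨h, -⟩, h'⟩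
          exact ⟨h, h'⟩
      · intro e he
        rw [(Finset.mem_filter.1 he).2]
    · intro e he
      simpa using (Finset.mem_filter.1 he).2.2
  · rw [← Finset.prod_filter, Finset.filter_filter, Finset.prod_inv_distrib]
    congr 1
    refine Finset.prod_congr ?_ fun _ _ => rfl
    ext S
    simp [and_comm]

end CliqueTree

/-- The two approximations give the rates of any counting numbers on cliques. -/
theorem backoff_cliqueApprox {V : Type*} [Fintype V] [DecidableEq V] {G : SimpleGraph V}
    {d : Finset V → ℤ} (hd : IsCliqueCounting G Finset.univ d) (φ : V → ℝ) :
    (cliqueApprox G (Fintype.card V)).backoff φ = cliqueRate d φ := by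
  rw [(isCliqueFamily_cliqueApprox G).backoff_eq, hd.unique (isCliqueCounting_cliqueApprox G)]

theorem backoff_maxCliqueKikuchi {V : Type*} [Fintype V] [DecidableEq V] {G : SimpleGraph V}
    {d : Finset V → ℤ} (hd : IsCliqueCounting G Finset.univ d) (φ : V → ℝ) :
    (maxCliqueKikuchi G).backoff φ = cliqueRate d φ := by
  cases isEmpty_or_nonempty V
  -- Without nodes the empty set is a maximal clique, so the family would not consist of nonempty
  -- cliques; but then there are no rates to compare.
  · exact Subsingleton.elim _ _
  · rw [(isCliqueFamily_maxCliqueKikuchi G).backoff_eq,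
      hd.unique (isCliqueCounting_maxCliqueKikuchi G)]

end CSMA

end

theorem mainTheorem8 {V : Type*} [Fintype V] [DecidableEq V] (G : SimpleGraph V)
    (hG : CSMA.IsChordal G) (φ : V → ℝ) (hφ : φ ∈ CSMA.achievable G) :
    (∀ T : SimpleGraph {K : Finset V // K ∈ CSMA.maxCliques G}, CSMA.IsCliqueTree G T →
      (∀ i, (CSMA.cliqueApprox G (Fintype.card V)).backoff φ i = CSMA.chordalRate G T φ i) ∧
      (∀ i, (CSMA.maxCliqueKikuchi G).backoff φ i = CSMA.chordalRate G T φ i)) ∧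
    CSMA.IsExact G φ ((CSMA.cliqueApprox G (Fintype.card V)).backoff φ) ∧
    CSMA.IsExact G φ ((CSMA.maxCliqueKikuchi G).backoff φ) := by
  have hd := CSMA.isCliqueCounting_cliqueApprox G
  refine ⟨fun T hT => ⟨fun i => ?_, fun i => ?_⟩, ?_, ?_⟩
  · rw [CSMA.backoff_cliqueApprox hT.isCliqueCounting,
      CSMA.cliqueRate_treeCounting T (CSMA.sum_clique_lt_one hφ)]
  · rw [CSMA.backoff_maxCliqueKikuchi hT.isCliqueCounting,
      CSMA.cliqueRate_treeCounting T (CSMA.sum_clique_lt_one hφ)]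
  · rw [CSMA.backoff_cliqueApprox hd]
    exact hG.isExact_cliqueRate hφ hd
  · rw [CSMA.backoff_maxCliqueKikuchi hd]
    exact hG.isExact_cliqueRate hφ hd
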